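/- **Conventions.** Let $k$ be a field complete for a non-Archimedean absolute value (possibly trivial). A *root datum* consists of: a free $\mathbb{Z}$-module $\Phi$ with linearly independent elements $\alpha_i$ ($i\in I$, an arbitrary set); a symmetric bilinear form $(\cdot,\cdot):\Phi\times\Phi\to\mathbb{Q}$ with $(\alpha_i,\alpha_i)\in\{2,4,6,\dots\}$ and $(\alpha_i,\alpha_j)\le 0$ for $i\ne j$; and homomorphisms $\lambda_i:\Phi\to\mathbb{Z}$ with $\lambda_i(\alpha)=2(\alpha_i,\alpha)/(\alpha_i,\alpha_i)$. Its enveloping algebra $U(\mathfrak{g})$ is the unital associative $k$-algebra generated by $F_i,H_i,E_i$ ($i\in I$) with the relations $$[H_i,H_j]=0,\quad [H_i,E_j]=(\alpha_i,\alpha_j)E_j,\quad [H_i,F_j]=-(\alpha_i,\alpha_j)F_j,\quad [E_i,F_j]=\delta_{ij}H_i,$$ and, for $i\neq j$ and $N=1-\lambda_i(\alpha_j)$, $$\sum_{m=0}^{N}(-1)^m\binom{N}{m}E_i^{N-m}E_jE_i^m=0=\sum_{m=0}^{N}(-1)^m\binom{N}{m}F_i^{N-m}F_jF_i^m .$$ For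 $r,s>0$ with $rs\ge 1$, write $T=k\langle v_i\rangle\otimes k[H_i]\otimes k\langle v_i\rangle$ (free algebras on $v_i$, $i\in I$, and a polynomial algebra) and give it the maximum norm in which a monomial $w\otimes h\otimes w'$ has norm $r^{|w|}s^{|w'|}$, where $|w|$ is the length of the word $w$. The linear map $T\to U(\mathfrak{g})$ sending $w\otimes h\otimes w'$ to the product of $w$ with $v_i=F_i$, of $h$, and of $w'$ with $v_i=E_i$, is onto. Its quotient seminorm on $U(\mathfrak{g})$ is submultiplicative, and $U(\mathfrak{g})^{\mathrm{an}}_{r,s}$ denotes the Banach algebra which is the completion. Let $\mathfrak{g}_{r,s}\subset U(\mathfrak{g})^{\mathrm{an}}_{r,s}$ be the smallest closed Lie subalgebra (for the commutator bracket) containing all $F_i,H_i,E_i$. For a non-Archimedean Banach $k$-algebra $A$ and $\varepsilon>0$ let $A\{\frac{\hslash}{\varepsilon}\}$ be the algebra of power series $\sum_{n\ge0} a_n\hslash^n$ ($\hslash$ central, $a_n\in A$) with $\|a_n\|\varepsilon^n\to0$, with the norm $\sup_n\|a_n\|\varepsilon^n$. It is an algebra over $k\{\frac{\hslash}{\varepsilon}\}$.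 For a Banach space $M$ with an action of the Lie algebra $L=\mathfrak{g}_{r,s}$, let $C_b^n(L,M)$ be the space of bounded alternating $n$-linear maps $L^n\to M$ with the operator norm. So $C_b^0(L,M)=M$. Let $$\delta_n(f)(x_1,\dots,x_{n+1})=\sum_{i<j}(-1)^{i+j}f([x_i,x_j],x_1,\dots,\widehat{x_i},\dots,\widehat{x_j},\dots,x_{n+1})+\sum_{i}(-1)^{i+1}x_i\cdot f(x_1,\dots,\widehat{x_i},\dots,x_{n+1}).$$ The complex is *strictly exact* at $C_b^{1}(L,M)$ if $\mathrm{Ker}(\delta_{1})=\mathrm{Im}(\delta_0)$ and the bijection $M/\mathrm{Ker}(\delta_0)\to\mathrm{Im}(\delta_0)$ induced by $\delta_0$ has a bounded inverse, where $M/\mathrm{Ker}(\delta_0)$ has the quotient norm. **Theorem.** Let $U=U(\mathfrak{g})^{\mathrm{an}}_{r,s}$ and $U'=U(\mathfrak{g}')^{\mathrm{an}}_{r',s'}$ be obtained in this way from two root data and from radii $r,s>0$, $rs\ge1$, and $r',s'>0$, $r's'\ge1$. Let $0<\varepsilon<1$ and let $$\alpha,\alpha':U\{\tfrac{\hslash}{\varepsilon}\}\to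 U'\{\tfrac{\hslash}{\varepsilon}\}$$ be morphisms of (unital) $k\{\frac{\hslash}{\varepsilon}\}$-algebras with $\|\alpha\|\le1$, $\|\alpha'\|\le1$ and $\alpha\equiv\alpha'$ modulo $\hslash$. Let $\alpha_0:U\to U'$ be the common reduction of $\alpha$ and $\alpha'$ modulo $\hslash$, and let $x\in\mathfrak{g}_{r,s}$ act on $U'$ by $x\cdot m=\alpha_0(x)m-m\alpha_0(x)$. Suppose that $C_b^\bullet(\mathfrak{g}_{r,s},U')$ is strictly exact at $C_b^1(\mathfrak{g}_{r,s},U')$ and that the inverse isomorphism $$\mathrm{Ker}(\delta_1)=\mathrm{Im}(\delta_0)\overset{\sim}{\longrightarrow}U'/\mathrm{Ker}(\delta_0)$$ is contracting (has norm at most $1$). Then for every $\varepsilon'$ with $0<\varepsilon'<\varepsilon$ there is an invertible element $F\in U'\{\frac{\hslash}{\varepsilon'}\}$ such that $$\alpha'(x)=F\,\alpha(x)\,F^{-1}\qquad\text{for all }x\in U\{\tfrac{\hslash}{\varepsilon'}\},$$ where $\alpha,\alpha'$ now denote the morphisms $U\{\frac{\hslash}{\varepsilon'}\}\to U'\{\frac{\hslash}{\varepsilon'}\}$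 of $k\{\frac{\hslash}{\varepsilon'}\}$-algebras obtained by base change, $\sum_i x_i\hslash^i\mapsto\sum_i\alpha(x_i)\hslash^i$ and likewise for $\alpha'$. -/

import Mathlib

open scoped Topology

noncomputable section

namespace Rigidity

/-! ## Root data and the enveloping algebra -/

/-- A (Kac-Moody) root datum, with simple roots indexed by an arbitrary set `I` and with weight
lattice `Φ`; the root lattice is the span of the simple roots. -/
structure RootDatum (I Φ : Type*) [AddCommGroup Φ] where
  /-- the weight lattice is a free abelian group -/
  free : Module.Free ℤ Φ
  /-- the simple roots `α i`, a free basis of the root lattice -/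
  root : I → Φ
  linearIndependent : LinearIndependent ℤ root
  /-- the symmetric bilinear form -/
  form : Φ →ₗ[ℤ] Φ →ₗ[ℤ] ℚ
  symm : ∀ a b, form a b = form b a
  form_self : ∀ i, ∃ n : ℕ, 0 < n ∧ form (root i) (root i) = 2 * n
  form_nonpos : ∀ i j, i ≠ j → form (root i) (root j) ≤ 0
  /-- the simple coroots -/
  coroot : I → Φ →ₗ[ℤ] ℤ
  coroot_apply : ∀ i a, (coroot i a : ℚ) = 2 * form (root i) a / form (root i) (root i)

namespace RootDatum

variable {I Φ : Type*} [AddCommGroup Φ] (D : RootDatum I Φ)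

/-- The number `(α i, α j)`, which is an integer, see `pairing_cast`. -/
def pairing (i j : I) : ℤ := (D.form (D.root i) (D.root j)).num

theorem pairing_cast (i j : I) : (D.pairing i j : ℚ) = D.form (D.root i) (D.root j) := by
  obtain ⟨n, hn, h⟩ := D.form_self i
  have h2 := D.coroot_apply i (D.root j)
  have hn' : (n : ℚ) ≠ 0 := by positivity
  have h3 : D.form (D.root i) (D.root j) = ((D.coroot i (D.root j) * n : ℤ) : ℚ) := by
    rw [h] at h2
    push_cast
    rw [h2]
    field_simp
  rw [pairing, h3, Rat.num_intCast]

/-- The number `1 - a_{ij}` where `a_{ij} = λ_i (α_j)` is the entry of the Cartan matrix. This is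
the degree in `i` of the Serre relation between `i ≠ j`. -/
def serreDegree (i j : I) : ℕ := (1 - D.coroot i (D.root j)).toNat

end RootDatum

/-- The names of the generators. -/
inductive Gen (I : Type*)
  | F (i : I)
  | H (i : I)
  | E (i : I)

section Enveloping

variable (k : Type*) [NormedField k] {I Φ : Type*} [AddCommGroup Φ] (D : RootDatum I Φ)

/-- `∑_m (-1)^m (N choose m) x^(N-m) y x^m`. -/
def serre {R : Type*} [Ring R] (N : ℕ) (x y : R) : R :=
  ∑ m ∈ Finset.range (N + 1), ((-1) ^ m * (N.choose m : ℤ)) • (x ^ (N - m) * y * x ^ m)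

/-- The free algebra on the generators. -/
abbrev FreeGen (k : Type*) [NormedField k] (I : Type*) := FreeAlgebra k (Gen I)

/-- A generator as an element of the free algebra. -/
abbrev gen (g : Gen I) : FreeGen k I := FreeAlgebra.ι k g

/-- The defining relations of `U(𝔤)`. -/
inductive Rel : FreeGen k I → FreeGen k I → Prop
  | hh (i j : I) : Rel (gen k (.H i) * gen k (.H j)) (gen k (.H j) * gen k (.H i))
  | he (i j : I) : Rel (gen k (.H i) * gen k (.E j) - gen k (.E j) * gen k (.H i))
      (D.pairing i j • gen k (.E j))
  | hf (i j : I) : Rel (gen k (.H i) * gen k (.F j) - gen k (.F j) * gen k (.H i))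
      (-(D.pairing i j • gen k (.F j)))
  | ef (i : I) : Rel (gen k (.E i) * gen k (.F i) - gen k (.F i) * gen k (.E i)) (gen k (.H i))
  | ef_ne (i j : I) (h : i ≠ j) :
      Rel (gen k (.E i) * gen k (.F j) - gen k (.F j) * gen k (.E i)) 0
  | serreE (i j : I) (h : i ≠ j) :
      Rel (serre (D.serreDegree i j) (gen k (.E i)) (gen k (.E j))) 0
  | serreF (i j : I) (h : i ≠ j) :
      Rel (serre (D.serreDegree i j) (gen k (.F i)) (gen k (.F j))) 0

/-- The enveloping algebra `U(𝔤)` over `k`. -/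
def Enveloping : Type _ := RingQuot (Rel k D)

namespace Enveloping

instance : Ring (Enveloping k D) := inferInstanceAs (Ring (RingQuot (Rel k D)))

instance : Algebra k (Enveloping k D) := inferInstanceAs (Algebra k (RingQuot (Rel k D)))

/-- The quotient map from the free algebra. -/
def mk : FreeGen k I →ₐ[k] Enveloping k D := RingQuot.mkAlgHom k (Rel k D)

/-- The generators `F_i` of `U(𝔤)`. -/
def F (i : I) : Enveloping k D := mk k D (gen k (.F i))

/-- The generators `H_i` of `U(𝔤)`. -/
def H (i : I) : Enveloping k D := mk k D (gen k (.H i))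

/-- The generators `E_i` of `U(𝔤)`. -/
def E (i : I) : Enveloping k D := mk k D (gen k (.E i))

variable {k D} in
theorem mk_rel {x y : FreeGen k I} (h : Rel k D x y) : mk k D x = mk k D y :=
  RingQuot.mkAlgHom_rel k h

theorem H_comm (i j : I) : H k D i * H k D j = H k D j * H k D i := by
  simpa [H] using mk_rel (Rel.hh (k := k) (D := D) i j)

theorem E_mul_H (i j : I) :
    E k D i * H k D j = H k D j * E k D i - D.pairing j i • E k D i := by
  have := mk_rel (Rel.he (k := k) (D := D) j i)
  simp only [map_sub, map_mul, map_zsmul] at this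
  rw [E, H, ← this]
  abel

theorem H_mul_F (i j : I) :
    H k D i * F k D j = F k D j * H k D i - D.pairing i j • F k D j := by
  have := mk_rel (Rel.hf (k := k) (D := D) i j)
  simp only [map_sub, map_mul, map_zsmul, map_neg] at this
  rw [F, H, sub_eq_iff_eq_add.1 this]
  abel

theorem E_mul_F (i : I) : E k D i * F k D i = F k D i * E k D i + H k D i := by
  have := mk_rel (Rel.ef (k := k) (D := D) i)
  simp only [map_sub, map_mul] at this
  rw [E, F, H, sub_eq_iff_eq_add.1 this]
  abel

theorem E_mul_F_ne (i j : I) (h : i ≠ j) : E k D i * F k D j = F k D j * E k D i := by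
  have := mk_rel (Rel.ef_ne (k := k) (D := D) i j h)
  simp only [map_sub, map_mul, map_zero] at this
  exact sub_eq_zero.1 this

theorem H_pairwise (h : Multiset I) :
    {x | x ∈ h.map (H k D)}.Pairwise Commute := by
  intro x hx y hy _
  obtain ⟨i, _, rfl⟩ := Multiset.mem_map.1 hx
  obtain ⟨j, _, rfl⟩ := Multiset.mem_map.1 hy
  exact H_comm k D i j

end Enveloping

end Enveloping

/-! ## The norm of the triangular tensor product -/

/-- The radii `r, s > 0` with `1 ≤ r s`. -/
structure Radii where
  /-- the norm of the `F i` -/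
  r : ℝ
  /-- the norm of the `E i` -/
  s : ℝ
  r_pos : 0 < r
  s_pos : 0 < s
  one_le : 1 ≤ r * s

/-- The standard basis of (noncommutative words in the `F`) ⊗ (commutative monomials in the `H`) ⊗
(noncommutative words in the `E`). -/
abbrev TriIndex (I : Type*) := List I × Multiset I × List I

/-- The norm of a basis element of `T_r(V₀) ⊗ k{H} ⊗ T_s(V₀)`. -/
def Radii.weight (ρ : Radii) {I : Type*} (m : TriIndex I) : ℝ :=
  ρ.r ^ m.1.length * ρ.s ^ m.2.2.length

theorem Radii.weight_nonneg (ρ : Radii) {I : Type*} (m : TriIndex I) : 0 ≤ ρ.weight m :=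
  mul_nonneg (pow_nonneg ρ.r_pos.le _) (pow_nonneg ρ.s_pos.le _)

namespace Enveloping

variable (k : Type*) [NormedField k] {I Φ : Type*} [AddCommGroup Φ] (D : RootDatum I Φ)
  (ρ : Radii)

/-- The product in `U(𝔤)` of a word in the `F`, a monomial in the `H` and a word in the `E`. -/
def mono (m : TriIndex I) : Enveloping k D :=
  (m.1.map (F k D)).prod * (m.2.1.map (H k D)).noncommProd (H_pairwise k D m.2.1) *
    (m.2.2.map (E k D)).prod

/-- The map from the algebraic tensor product `T(V₀) ⊗ k[H] ⊗ T(V₀)` to `U(𝔤)`. -/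
def tri : (TriIndex I →₀ k) →ₗ[k] Enveloping k D := Finsupp.linearCombination k (mono k D)

/-- `BoundedBy c x`: the element `x` is the image of an element of `T_r(V₀) ⊗ k[H] ⊗ T_s(V₀)` of
(maximum) norm at most `c`. -/
def BoundedBy (c : ℝ) (x : Enveloping k D) : Prop :=
  0 ≤ c ∧ ∃ a : TriIndex I →₀ k, (∀ m, ‖a m‖ * ρ.weight m ≤ c) ∧ tri k D a = x

/-- The quotient norm on `U(𝔤)` induced from `T_r(V₀) ⊗ k[H] ⊗ T_s(V₀)`. -/
def triNorm (x : Enveloping k D) : ℝ := sInf {c : ℝ | BoundedBy k D ρ c x}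

variable {k D ρ}

theorem BoundedBy.mono_left {c d : ℝ} {x : Enveloping k D} (h : BoundedBy k D ρ c x)
    (hcd : c ≤ d) : BoundedBy k D ρ d x :=
  ⟨h.1.trans hcd, h.2.imp fun _ ha => ⟨fun m => (ha.1 m).trans hcd, ha.2⟩⟩

theorem BoundedBy.zero {c : ℝ} (hc : 0 ≤ c) : BoundedBy k D ρ c (0 : Enveloping k D) :=
  ⟨hc, 0, fun m => by simpa using hc, map_zero _⟩

theorem BoundedBy.neg {c : ℝ} {x : Enveloping k D} (h : BoundedBy k D ρ c x) :
    BoundedBy k D ρ c (-x) := by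
  obtain ⟨hc, a, ha, rfl⟩ := h
  exact ⟨hc, -a, fun m => by simpa using ha m, map_neg _ _⟩

theorem BoundedBy.smul {c : ℝ} {x : Enveloping k D} (t : k) (h : BoundedBy k D ρ c x) :
    BoundedBy k D ρ (‖t‖ * c) (t • x) := by
  obtain ⟨hc, a, ha, rfl⟩ := h
  refine ⟨mul_nonneg (norm_nonneg _) hc, t • a, fun m => ?_, map_smul _ _ _⟩
  rw [Finsupp.smul_apply, smul_eq_mul, norm_mul, mul_assoc]
  exact mul_le_mul_of_nonneg_left (ha m) (norm_nonneg _)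

theorem BoundedBy.mono (m : TriIndex I) :
    BoundedBy k D ρ (ρ.weight m) (mono k D m) := by
  classical
  refine ⟨ρ.weight_nonneg m, Finsupp.single m 1, fun m' => ?_, by simp [tri]⟩
  rw [Finsupp.single_apply]
  split_ifs with h
  · simp [h]
  · simpa using ρ.weight_nonneg m

theorem F_mul_mono (i : I) (w : List I) (h : Multiset I) (w' : List I) :
    F k D i * mono k D (w, h, w') = mono k D (i :: w, h, w') := by
  simp [mono, mul_assoc]

theorem BoundedBy.one : BoundedBy k D ρ 1 (1 : Enveloping k D) := by
  have := BoundedBy.mono (k := k) (D := D) (ρ := ρ) (([] : List I), (0 : Multiset I), ([] : List I))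
  simpa [Radii.weight, Enveloping.mono] using this

theorem triNorm_nonneg (x : Enveloping k D) : 0 ≤ triNorm k D ρ x :=
  Real.sInf_nonneg fun _ h => h.1

theorem triNorm_le {c : ℝ} {x : Enveloping k D} (h : BoundedBy k D ρ c x) :
    triNorm k D ρ x ≤ c :=
  csInf_le ⟨0, fun _ h => h.1⟩ h

theorem triNorm_neg (x : Enveloping k D) : triNorm k D ρ (-x) = triNorm k D ρ x := by
  have (c : ℝ) : BoundedBy k D ρ c (-x) ↔ BoundedBy k D ρ c x :=
    ⟨fun h => by simpa using h.neg, fun h => h.neg⟩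
  simp only [triNorm, this]

theorem triNorm_zero : triNorm k D ρ (0 : Enveloping k D) = 0 :=
  le_antisymm (triNorm_le (BoundedBy.zero le_rfl)) (triNorm_nonneg _)

section Ultra

variable [IsUltrametricDist k]

theorem BoundedBy.add_max {c d : ℝ} {x y : Enveloping k D} (hx : BoundedBy k D ρ c x)
    (hy : BoundedBy k D ρ d y) : BoundedBy k D ρ (max c d) (x + y) := by
  obtain ⟨hc, a, ha, rfl⟩ := hx
  obtain ⟨hd, b, hb, rfl⟩ := hy
  refine ⟨le_max_of_le_left hc, a + b, fun m => ?_, map_add _ _ _⟩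
  have h1 := IsUltrametricDist.norm_add_le_max (a m) (b m)
  have h2 := ρ.weight_nonneg m
  rw [Finsupp.add_apply]
  refine (mul_le_mul_of_nonneg_right h1 h2).trans ?_
  rw [max_mul_of_nonneg _ _ h2]
  exact max_le_max (ha m) (hb m)

theorem BoundedBy.add {c : ℝ} {x y : Enveloping k D} (hx : BoundedBy k D ρ c x)
    (hy : BoundedBy k D ρ c y) : BoundedBy k D ρ c (x + y) := by
  simpa using hx.add_max hy

theorem BoundedBy.sub {c : ℝ} {x y : Enveloping k D} (hx : BoundedBy k D ρ c x)
    (hy : BoundedBy k D ρ c y) : BoundedBy k D ρ c (x - y) := by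
  simpa [sub_eq_add_neg] using hx.add hy.neg

theorem BoundedBy.zsmul {c : ℝ} {x : Enveloping k D} (n : ℤ) (hx : BoundedBy k D ρ c x) :
    BoundedBy k D ρ c (n • x) := by
  have h := hx.smul (n : k)
  rw [Int.cast_smul_eq_zsmul] at h
  exact h.mono_left (mul_le_of_le_one_left hx.1 (IsUltrametricDist.norm_intCast_le_one k n))

theorem BoundedBy.sum {ι : Type*} (t : Finset ι) {c : ℝ} (hc : 0 ≤ c) {x : ι → Enveloping k D}
    (hx : ∀ i ∈ t, BoundedBy k D ρ c (x i)) : BoundedBy k D ρ c (∑ i ∈ t, x i) := by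
  classical
  induction t using Finset.induction_on with
  | empty => simpa using BoundedBy.zero hc
  | insert i t hi ih =>
    rw [Finset.sum_insert hi]
    exact (hx i (by simp)).add (ih fun j hj => hx j (by simp [hj]))

/-- To bound left multiplication by an element it suffices to bound it on products. -/
theorem BoundedBy.mul_left_of_mono {g : Enveloping k D} {C : ℝ} (hC : 0 ≤ C)
    (h : ∀ m, BoundedBy k D ρ (C * ρ.weight m) (g * Enveloping.mono k D m)) {c : ℝ}
    {x : Enveloping k D} (hx : BoundedBy k D ρ c x) : BoundedBy k D ρ (C * c) (g * x) := by
  obtain ⟨hc, a, ha, rfl⟩ := hx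
  rw [tri, Finsupp.linearCombination_apply, Finsupp.sum, Finset.mul_sum]
  refine BoundedBy.sum _ (mul_nonneg hC hc) fun m _ => ?_
  rw [mul_smul_comm]
  refine ((h m).smul (a m)).mono_left ?_
  calc ‖a m‖ * (C * ρ.weight m) = C * (‖a m‖ * ρ.weight m) := by ring
    _ ≤ C * c := mul_le_mul_of_nonneg_left (ha m) hC

theorem BoundedBy.F_mul (i : I) {c : ℝ} {x : Enveloping k D} (hx : BoundedBy k D ρ c x) :
    BoundedBy k D ρ (ρ.r * c) (F k D i * x) := by
  refine BoundedBy.mul_left_of_mono ρ.r_pos.le (fun ⟨w, h, w'⟩ => ?_) hx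
  rw [F_mul_mono]
  refine (BoundedBy.mono _).mono_left (le_of_eq ?_)
  simp [Radii.weight, pow_succ]
  ring

theorem BoundedBy.H_mul (i : I) {c : ℝ} {x : Enveloping k D} (hx : BoundedBy k D ρ c x) :
    BoundedBy k D ρ c (H k D i * x) := by
  rw [← one_mul c]
  refine BoundedBy.mul_left_of_mono zero_le_one (fun ⟨w, h, w'⟩ => ?_) hx
  rw [one_mul]
  induction w with
  | nil =>
    have : H k D i * Enveloping.mono k D ([], h, w') =
        Enveloping.mono k D ([], i ::ₘ h, w') := by
      simp [Enveloping.mono, Multiset.noncommProd_cons, mul_assoc]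
    rw [this]
    exact BoundedBy.mono ([], i ::ₘ h, w')
  | cons j w ih =>
    rw [← F_mul_mono, ← mul_assoc, H_mul_F, sub_mul, mul_assoc, smul_mul_assoc]
    have hw : ρ.weight (j :: w, h, w') = ρ.r * ρ.weight (w, h, w') := by
      simp [Radii.weight, pow_succ]
      ring
    rw [hw]
    exact (ih.F_mul j).sub (((BoundedBy.mono _).F_mul j).zsmul _)

theorem BoundedBy.E_mul_nil (i : I) (h : Multiset I) (w' : List I) :
    BoundedBy k D ρ (ρ.s * ρ.weight (([] : List I), h, w'))
      (E k D i * Enveloping.mono k D ([], h, w')) := by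
  induction h using Multiset.induction_on with
  | empty =>
    have : E k D i * Enveloping.mono k D ([], 0, w') =
        Enveloping.mono k D ([], 0, i :: w') := by
      simp [Enveloping.mono]
    rw [this]
    refine (BoundedBy.mono _).mono_left (le_of_eq ?_)
    simp [Radii.weight, pow_succ]
    ring
  | cons j h ih =>
    have hj : Enveloping.mono k D ([], j ::ₘ h, w') =
        H k D j * Enveloping.mono k D ([], h, w') := by
      simp [Enveloping.mono, Multiset.noncommProd_cons, mul_assoc]
    rw [hj, ← mul_assoc, E_mul_H, sub_mul, mul_assoc, smul_mul_assoc]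
    exact (BoundedBy.H_mul j ih).sub (BoundedBy.zsmul _ ih)

theorem BoundedBy.E_mul (i : I) {c : ℝ} {x : Enveloping k D} (hx : BoundedBy k D ρ c x) :
    BoundedBy k D ρ (ρ.s * c) (E k D i * x) := by
  refine BoundedBy.mul_left_of_mono ρ.s_pos.le (fun ⟨w, h, w'⟩ => ?_) hx
  induction w with
  | nil => exact BoundedBy.E_mul_nil i h w'
  | cons j w ih =>
    have hw : ρ.weight (j :: w, h, w') = ρ.r * ρ.weight (w, h, w') := by
      simp [Radii.weight, pow_succ]
      ring
    have h1 : BoundedBy k D ρ (ρ.s * ρ.weight (j :: w, h, w'))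
        (F k D j * (E k D i * Enveloping.mono k D (w, h, w'))) :=
      (ih.F_mul j).mono_left (le_of_eq (by rw [hw]; ring))
    by_cases hij : i = j
    · subst hij
      rw [← F_mul_mono, ← mul_assoc, E_mul_F, add_mul, mul_assoc]
      refine h1.add (((BoundedBy.mono (w, h, w')).H_mul i).mono_left ?_)
      rw [hw]
      nlinarith [ρ.one_le, ρ.weight_nonneg (w, h, w')]
    · rw [← F_mul_mono, ← mul_assoc, E_mul_F_ne k D i j hij, mul_assoc]
      exact h1

theorem BoundedBy.mono_mul (m : TriIndex I) {c : ℝ} {x : Enveloping k D}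
    (hx : BoundedBy k D ρ c x) :
    BoundedBy k D ρ (ρ.weight m * c) (Enveloping.mono k D m * x) := by
  obtain ⟨w, h, w'⟩ := m
  induction w with
  | cons j w ih =>
    rw [← F_mul_mono, mul_assoc]
    refine (ih.F_mul j).mono_left (le_of_eq ?_)
    simp [Radii.weight, pow_succ]
    ring
  | nil =>
    induction h using Multiset.induction_on with
    | cons j h ih =>
      have hj : Enveloping.mono k D ([], j ::ₘ h, w') =
          H k D j * Enveloping.mono k D ([], h, w') := by
        simp [Enveloping.mono, Multiset.noncommProd_cons, mul_assoc]
      rw [hj, mul_assoc]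
      exact ih.H_mul j
    | empty =>
      induction w' with
      | nil => simpa [Radii.weight, Enveloping.mono] using hx
      | cons j w' ih =>
        have : Enveloping.mono k D ([], 0, j :: w') =
            E k D j * Enveloping.mono k D ([], 0, w') := by
          simp [Enveloping.mono]
        rw [this, mul_assoc]
        refine (ih.E_mul j).mono_left (le_of_eq ?_)
        simp [Radii.weight, pow_succ]
        ring

theorem BoundedBy.mul {c d : ℝ} {x y : Enveloping k D} (hx : BoundedBy k D ρ c x)
    (hy : BoundedBy k D ρ d y) : BoundedBy k D ρ (c * d) (x * y) := by
  obtain ⟨hc, a, ha, rfl⟩ := hx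
  rw [tri, Finsupp.linearCombination_apply, Finsupp.sum, Finset.sum_mul]
  refine BoundedBy.sum _ (mul_nonneg hc hy.1) fun m _ => ?_
  rw [smul_mul_assoc]
  refine ((hy.mono_mul m).smul (a m)).mono_left ?_
  rw [← mul_assoc]
  exact mul_le_mul_of_nonneg_right (ha m) hy.1

variable (ρ) in
theorem exists_boundedBy (x : Enveloping k D) : ∃ c, BoundedBy k D ρ c x := by
  obtain ⟨y, rfl⟩ : ∃ y, mk k D y = x := RingQuot.mkAlgHom_surjective k (Rel k D) x
  induction y using FreeAlgebra.induction with
  | grade0 t =>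
    refine ⟨‖t‖ * 1, ?_⟩
    rw [AlgHom.commutes, Algebra.algebraMap_eq_smul_one]
    exact BoundedBy.one.smul t
  | grade1 g =>
    cases g with
    | F i => exact ⟨_, by simpa [F] using (BoundedBy.one (k := k) (D := D) (ρ := ρ)).F_mul i⟩
    | H i => exact ⟨_, by simpa [H] using (BoundedBy.one (k := k) (D := D) (ρ := ρ)).H_mul i⟩
    | E i => exact ⟨_, by simpa [E] using (BoundedBy.one (k := k) (D := D) (ρ := ρ)).E_mul i⟩
  | mul a b ha hb =>
    obtain ⟨c, hc⟩ := ha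
    obtain ⟨d, hd⟩ := hb
    exact ⟨_, by rw [map_mul]; exact hc.mul hd⟩
  | add a b ha hb =>
    obtain ⟨c, hc⟩ := ha
    obtain ⟨d, hd⟩ := hb
    exact ⟨_, by rw [map_add]; exact hc.add_max hd⟩

theorem boundedBy_of_triNorm_lt {c : ℝ} {x : Enveloping k D} (h : triNorm k D ρ x < c) :
    BoundedBy k D ρ c x := by
  obtain ⟨d, hd, hdc⟩ := exists_lt_of_csInf_lt (exists_boundedBy ρ x) h
  exact BoundedBy.mono_left hd hdc.le

theorem triNorm_add_le_max (x y : Enveloping k D) :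
    triNorm k D ρ (x + y) ≤ max (triNorm k D ρ x) (triNorm k D ρ y) := by
  refine le_of_forall_gt_imp_ge_of_dense fun c hc => ?_
  rw [max_lt_iff] at hc
  exact triNorm_le ((boundedBy_of_triNorm_lt hc.1).add (boundedBy_of_triNorm_lt hc.2))

theorem triNorm_mul_le (x y : Enveloping k D) :
    triNorm k D ρ (x * y) ≤ triNorm k D ρ x * triNorm k D ρ y := by
  have key : ∀ t : ℝ, 0 < t →
      triNorm k D ρ (x * y) ≤ (triNorm k D ρ x + t) * (triNorm k D ρ y + t) := fun t ht =>
    triNorm_le ((boundedBy_of_triNorm_lt (lt_add_of_pos_right _ ht)).mul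
      (boundedBy_of_triNorm_lt (lt_add_of_pos_right _ ht)))
  have hlim : Filter.Tendsto (fun t : ℝ => (triNorm k D ρ x + t) * (triNorm k D ρ y + t))
      (𝓝[>] 0) (𝓝 (triNorm k D ρ x * triNorm k D ρ y)) := by
    have : Continuous fun t : ℝ => (triNorm k D ρ x + t) * (triNorm k D ρ y + t) := by fun_prop
    simpa using (this.tendsto 0).mono_left nhdsWithin_le_nhds
  exact ge_of_tendsto hlim (Filter.eventually_of_mem self_mem_nhdsWithin key)

theorem triNorm_smul_le (t : k) (x : Enveloping k D) :
    triNorm k D ρ (t • x) ≤ ‖t‖ * triNorm k D ρ x := by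
  have key : ∀ u : ℝ, 0 < u → triNorm k D ρ (t • x) ≤ ‖t‖ * (triNorm k D ρ x + u) := fun u hu =>
    triNorm_le ((boundedBy_of_triNorm_lt (lt_add_of_pos_right _ hu)).smul t)
  have hlim : Filter.Tendsto (fun u : ℝ => ‖t‖ * (triNorm k D ρ x + u))
      (𝓝[>] 0) (𝓝 (‖t‖ * triNorm k D ρ x)) := by
    have : Continuous fun u : ℝ => ‖t‖ * (triNorm k D ρ x + u) := by fun_prop
    simpa using (this.tendsto 0).mono_left nhdsWithin_le_nhds
  exact ge_of_tendsto hlim (Filter.eventually_of_mem self_mem_nhdsWithin key)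

end Ultra

end Enveloping

/-! ## The Banach algebra `U(𝔤)^an_{r,s}` and the Banach Lie algebra `𝔤_{r,s}` -/

section Analytic

variable (k : Type*) [NormedField k] [IsUltrametricDist k] {I Φ : Type*} [AddCommGroup Φ]
  (D : RootDatum I Φ) (ρ : Radii)

/-- The enveloping algebra `U(𝔤)`, to be equipped with the norm of radii `r, s`. -/
def NormedEnveloping (_ : Radii) : Type _ := Enveloping k D

namespace NormedEnveloping

instance : Ring (NormedEnveloping k D ρ) := inferInstanceAs (Ring (Enveloping k D))

instance : Algebra k (NormedEnveloping k D ρ) := inferInstanceAs (Algebra k (Enveloping k D))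

/-- The norm as a seminorm of additive groups. -/
def seminorm : AddGroupSeminorm (NormedEnveloping k D ρ) where
  toFun := Enveloping.triNorm k D ρ
  map_zero' := Enveloping.triNorm_zero
  add_le' x y := (Enveloping.triNorm_add_le_max x y).trans
    (max_le_add_of_nonneg (Enveloping.triNorm_nonneg _) (Enveloping.triNorm_nonneg _))
  neg' := Enveloping.triNorm_neg

instance : SeminormedRing (NormedEnveloping k D ρ) where
  __ := (inferInstance : Ring (NormedEnveloping k D ρ))
  __ := (seminorm k D ρ).toSeminormedAddCommGroup
  norm_mul_le := Enveloping.triNorm_mul_le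

theorem norm_def (x : NormedEnveloping k D ρ) : ‖x‖ = Enveloping.triNorm k D ρ x := rfl

instance : NormedAlgebra k (NormedEnveloping k D ρ) where
  norm_smul_le := Enveloping.triNorm_smul_le

instance : IsUltrametricDist (NormedEnveloping k D ρ) :=
  IsUltrametricDist.isUltrametricDist_of_forall_norm_add_le_max_norm
    Enveloping.triNorm_add_le_max

end NormedEnveloping

/-- The Banach algebra `U(𝔤)^an_{r,s}`: the completion of `U(𝔤) = U⁻ ⊗ U⁰ ⊗ U⁺` for the norm of
`U⁻_r ⊗ k{H} ⊗ U⁺_s`. -/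
def UAn : Type _ := UniformSpace.Completion (NormedEnveloping k D ρ)

namespace UAn

instance : NormedRing (UAn k D ρ) :=
  inferInstanceAs (NormedRing (UniformSpace.Completion (NormedEnveloping k D ρ)))

instance : CompleteSpace (UAn k D ρ) :=
  inferInstanceAs (CompleteSpace (UniformSpace.Completion (NormedEnveloping k D ρ)))

instance : NormedAlgebra k (UAn k D ρ) where
  __ := (inferInstance : Algebra k (UniformSpace.Completion (NormedEnveloping k D ρ)))
  norm_smul_le := norm_smul_le (α := k)
    (β := UniformSpace.Completion (NormedEnveloping k D ρ))

/-- The canonical map `U(𝔤) → U(𝔤)^an_{r,s}`. -/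
def of : NormedEnveloping k D ρ →+* UAn k D ρ :=
  UniformSpace.Completion.coeRingHom

theorem norm_of (x : NormedEnveloping k D ρ) : ‖of k D ρ x‖ = ‖x‖ :=
  UniformSpace.Completion.norm_coe x

theorem denseRange_of : DenseRange (of k D ρ) :=
  UniformSpace.Completion.denseRange_coe

instance : IsUltrametricDist (UAn k D ρ) := by
  refine IsUltrametricDist.isUltrametricDist_of_forall_norm_add_le_max_norm fun x y => ?_
  refine (denseRange_of k D ρ).induction_on₂ (p := fun x y => ‖x + y‖ ≤ max ‖x‖ ‖y‖)
    ?_ (fun a b => ?_) x y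
  · exact isClosed_le (by fun_prop) (by fun_prop)
  · rw [← map_add, norm_of, norm_of, norm_of]
    exact IsUltrametricDist.norm_add_le_max a b

/-- The commutator bracket. -/
instance : LieRing (UAn k D ρ) := LieRing.ofAssociativeRing

instance : LieAlgebra k (UAn k D ρ) := LieAlgebra.ofAssociativeAlgebra

/-- The generators `F_i`, `H_i`, `E_i` of `U(𝔤)^an_{r,s}`. -/
def generator (g : Gen I) : UAn k D ρ := of k D ρ (Enveloping.mk k D (gen k g))

/-- The Banach Lie algebra `𝔤_{r,s}`: the closed Lie subalgebra of `U(𝔤)^an_{r,s}` generated by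
the `F_i`, `H_i`, `E_i`. -/
def lie : LieSubalgebra k (UAn k D ρ) :=
  sInf {K | IsClosed (K : Set (UAn k D ρ)) ∧ Set.range (generator k D ρ) ⊆ K}

end UAn

end Analytic

/-! ## Convergent power series in `ħ` -/

section Tate

variable (A : Type*) [NormedRing A] [IsUltrametricDist A] (ε : ℝ)

/-- `A{ħ/ε}`: the power series `∑ a_n ħ^n` over `A` with `‖a_n‖ ε^n → 0`. -/
def Tate : Type _ := ↥(PowerSeries.IsRestricted.subring (R := A) ε)

namespace Tate

instance : Ring (Tate A ε) :=
  inferInstanceAs (Ring ↥(PowerSeries.IsRestricted.subring (R := A) ε))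

instance (k : Type*) [NormedField k] [IsUltrametricDist k] : CommRing (Tate k ε) :=
  inferInstanceAs (CommRing ↥(PowerSeries.IsRestricted.subring (R := k) ε))

variable {A ε}

/-- The underlying formal power series. -/
def toPowerSeries : Tate A ε →+* PowerSeries A :=
  (PowerSeries.IsRestricted.subring (R := A) ε).subtype

theorem toPowerSeries_injective : Function.Injective (toPowerSeries (A := A) (ε := ε)) :=
  Subtype.val_injective

/-- The coefficient of `ħ^n`. -/
def coeff (n : ℕ) (x : Tate A ε) : A := PowerSeries.coeff n (toPowerSeries x)

theorem tendsto_coeff (x : Tate A ε) :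
    Filter.Tendsto (fun n => ‖coeff n x‖ * ε ^ n) Filter.atTop (𝓝 0) :=
  (PowerSeries.isRestricted_iff' ε _).1 x.2

/-- A power series whose coefficients satisfy the convergence condition. -/
def ofPowerSeries (f : PowerSeries A)
    (hf : Filter.Tendsto (fun n => ‖PowerSeries.coeff n f‖ * ε ^ n) Filter.atTop (𝓝 0)) :
    Tate A ε :=
  ⟨f, (PowerSeries.isRestricted_iff' ε f).2 hf⟩

@[simp] theorem toPowerSeries_ofPowerSeries (f : PowerSeries A) (hf) :
    toPowerSeries (ofPowerSeries (ε := ε) f hf) = f := rfl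

@[ext] theorem ext {x y : Tate A ε} (h : ∀ n, coeff n x = coeff n y) : x = y :=
  toPowerSeries_injective (PowerSeries.ext h)

@[simp] theorem coeff_add (n : ℕ) (x y : Tate A ε) : coeff n (x + y) = coeff n x + coeff n y := by
  simp [coeff]

@[simp] theorem coeff_zero (n : ℕ) : coeff n (0 : Tate A ε) = 0 := by
  simp [coeff]

theorem coeff_mul (n : ℕ) (x y : Tate A ε) :
    coeff n (x * y) = ∑ p ∈ Finset.HasAntidiagonal.antidiagonal n, coeff p.1 x * coeff p.2 y := by
  simp [coeff, PowerSeries.coeff_mul]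

/-- The norm `‖∑ a_n ħ^n‖ = sup_n ‖a_n‖ ε^n`. -/
instance : Norm (Tate A ε) := ⟨fun x => ⨆ n, ‖coeff n x‖ * ε ^ n⟩

theorem norm_def (x : Tate A ε) : ‖x‖ = ⨆ n, ‖coeff n x‖ * ε ^ n := rfl

theorem norm_coeff_le (x : Tate A ε) (n : ℕ) : ‖coeff n x‖ * ε ^ n ≤ ‖x‖ :=
  le_ciSup (tendsto_coeff x).bddAbove_range n

/-- The inclusion `A → A{ħ/ε}`. -/
def const : A →+* Tate A ε :=
  (PowerSeries.C (R := A)).codRestrict (PowerSeries.IsRestricted.subring (R := A) ε)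
    (fun a => PowerSeries.isRestricted_C ε a)

theorem coeff_const (n : ℕ) (a : A) : coeff n (const (ε := ε) a) = if n = 0 then a else 0 :=
  PowerSeries.coeff_C n a

theorem norm_const_le (a : A) : ‖const (ε := ε) a‖ ≤ ‖a‖ := by
  refine ciSup_le fun n => ?_
  rw [coeff_const]
  split_ifs with h
  · simp [h]
  · simp

variable (A ε) in
/-- The element `ħ`. -/
def hbar : Tate A ε :=
  ⟨PowerSeries.X, PowerSeries.isRestricted_monomial ε 1 1⟩

theorem toPowerSeries_hbar : toPowerSeries (hbar A ε) = PowerSeries.X := rfl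

section Algebra

variable {k : Type*} [NormedField k] [IsUltrametricDist k] [NormedAlgebra k A]

variable (k A ε) in
/-- The map `k{ħ/ε} → A{ħ/ε}`, applying `k → A` to the coefficients. -/
def scalar : Tate k ε →+* Tate A ε :=
  ((PowerSeries.map (algebraMap k A)).comp toPowerSeries).codRestrict
    (PowerSeries.IsRestricted.subring (R := A) ε) (fun c => by
      refine (PowerSeries.isRestricted_iff' ε _).2 ?_
      have h := (tendsto_coeff c).const_mul ‖(1 : A)‖
      rw [mul_zero] at h
      refine h.congr fun n => ?_
      rw [RingHom.comp_apply, PowerSeries.coeff_map, norm_algebraMap, coeff]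
      ring)

theorem coeff_scalar (n : ℕ) (c : Tate k ε) :
    coeff n (scalar A ε k c) = algebraMap k A (coeff n c) :=
  PowerSeries.coeff_map _ _ _

/-- `A{ħ/ε}` as an algebra over `k{ħ/ε}`. -/
instance : Algebra (Tate k ε) (Tate A ε) :=
  (scalar A ε k).toAlgebra' fun c x => by
    ext n
    rw [coeff_mul, coeff_mul, ← Finset.Nat.sum_antidiagonal_swap]
    refine Finset.sum_congr rfl fun p _ => ?_
    simp [coeff_scalar, Algebra.commutes]

theorem algebraMap_def (c : Tate k ε) : algebraMap (Tate k ε) (Tate A ε) c = scalar A ε k c := rfl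

theorem scalar_const (c : k) :
    scalar A ε k (const c) = const (algebraMap k A c) := by
  ext n
  rw [coeff_scalar, coeff_const, coeff_const]
  split_ifs <;> simp

theorem scalar_hbar : scalar A ε k (hbar k ε) = hbar A ε :=
  toPowerSeries_injective (PowerSeries.map_X _)

end Algebra

end Tate

end Tate

/-! ## Morphisms of `k{ħ/ε}`-algebras: reduction modulo `ħ` and base change -/

section Morphisms

namespace Tate

variable {k : Type*} [NormedField k] [IsUltrametricDist k]
  {A : Type*} [NormedRing A] [IsUltrametricDist A] [NormedAlgebra k A]
  {B : Type*} [NormedRing B] [IsUltrametricDist B] [NormedAlgebra k B]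
  {ε ε' : ℝ}

theorem map_const_algebraMap (α : Tate A ε →ₐ[Tate k ε] Tate B ε) (c : k) :
    α (const (algebraMap k A c)) = const (algebraMap k B c) := by
  rw [← scalar_const, ← scalar_const, ← algebraMap_def, ← algebraMap_def, AlgHom.commutes]

/-- The reduction `α₀ : A → B` of `α : A{ħ/ε} → B{ħ/ε}` modulo `ħ`. -/
def reduction (α : Tate A ε →ₐ[Tate k ε] Tate B ε) : A →ₐ[k] B where
  __ := ((PowerSeries.constantCoeff (R := B)).comp toPowerSeries).comp
    ((α : Tate A ε →+* Tate B ε).comp const)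
  commutes' c := by
    change PowerSeries.constantCoeff (toPowerSeries (α (const (algebraMap k A c)))) = _
    rw [map_const_algebraMap]
    exact PowerSeries.constantCoeff_C _

theorem reduction_apply (α : Tate A ε →ₐ[Tate k ε] Tate B ε) (a : A) :
    reduction α a = coeff 0 (α (const a)) :=
  (PowerSeries.coeff_zero_eq_constantCoeff_apply _).symm

/-- The map on power series `∑ x_i ħ^i ↦ ∑ α(x_i) ħ^i`. -/
def extendFun (α : Tate A ε →ₐ[Tate k ε] Tate B ε) (x : PowerSeries A) : PowerSeries B :=
  PowerSeries.mk fun n =>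
    ∑ p ∈ Finset.HasAntidiagonal.antidiagonal n, coeff p.2 (α (const (PowerSeries.coeff p.1 x)))

theorem coeff_extendFun (α : Tate A ε →ₐ[Tate k ε] Tate B ε) (x : PowerSeries A) (n : ℕ) :
    PowerSeries.coeff n (extendFun α x) =
      ∑ p ∈ Finset.HasAntidiagonal.antidiagonal n, coeff p.2 (α (const (PowerSeries.coeff p.1 x))) :=
  PowerSeries.coeff_mk _ _

theorem coeff_sum {ι : Type*} (t : Finset ι) (f : ι → Tate A ε) (n : ℕ) :
    coeff n (∑ i ∈ t, f i) = ∑ i ∈ t, coeff n (f i) := by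
  simp [coeff]

theorem extendFun_map_algebraMap (α : Tate A ε →ₐ[Tate k ε] Tate B ε) (c : PowerSeries k) :
    extendFun α (PowerSeries.map (algebraMap k A) c) = PowerSeries.map (algebraMap k B) c := by
  ext n
  rw [coeff_extendFun, Finset.sum_eq_single (n, 0)]
  · simp [map_const_algebraMap, coeff_const]
  · rintro ⟨i, j⟩ hp hne
    rw [Finset.HasAntidiagonal.mem_antidiagonal] at hp
    have hj : j ≠ 0 := by
      rintro rfl
      exact hne (by simpa using hp)
    simp [map_const_algebraMap, coeff_const, hj]
  · simp

theorem extendFun_add (α : Tate A ε →ₐ[Tate k ε] Tate B ε) (x y : PowerSeries A) :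
    extendFun α (x + y) = extendFun α x + extendFun α y := by
  ext n
  simp [coeff_extendFun, Finset.sum_add_distrib]

theorem extendFun_mul (α : Tate A ε →ₐ[Tate k ε] Tate B ε) (x y : PowerSeries A) :
    extendFun α (x * y) = extendFun α x * extendFun α y := by
  ext n
  rw [PowerSeries.coeff_mul]
  simp only [coeff_extendFun, PowerSeries.coeff_mul, map_sum, map_mul, coeff_sum, coeff_mul,
    Finset.sum_mul_sum]
  simp only [← Finset.sum_product', Finset.sum_sigma']
  refine Finset.sum_nbij'
    (fun t => ⟨(t.2.1.1 + t.2.2.1, t.2.1.2 + t.2.2.2), ((t.2.1.1, t.2.2.1), (t.2.1.2, t.2.2.2))⟩)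
    (fun t => ⟨(t.2.1.1 + t.2.2.1, t.2.1.2 + t.2.2.2), ((t.2.1.1, t.2.2.1), (t.2.1.2, t.2.2.2))⟩)
    ?_ ?_ ?_ ?_ ?_
  · rintro ⟨⟨a, b⟩, ⟨⟨c, d⟩, ⟨e, f⟩⟩⟩ h
    simp only [Finset.mem_sigma, Finset.mem_product,
      Finset.HasAntidiagonal.mem_antidiagonal] at h ⊢
    obtain ⟨rfl, rfl, rfl⟩ := h
    simp only [and_true]
    omega
  · rintro ⟨⟨a, b⟩, ⟨⟨c, d⟩, ⟨e, f⟩⟩⟩ h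
    simp only [Finset.mem_sigma, Finset.mem_product,
      Finset.HasAntidiagonal.mem_antidiagonal] at h ⊢
    obtain ⟨rfl, rfl, rfl⟩ := h
    simp only [and_true]
    omega
  · rintro ⟨⟨a, b⟩, ⟨⟨c, d⟩, ⟨e, f⟩⟩⟩ h
    simp only [Finset.mem_sigma, Finset.mem_product,
      Finset.HasAntidiagonal.mem_antidiagonal] at h
    obtain ⟨-, rfl, rfl⟩ := h
    rfl
  · rintro ⟨⟨a, b⟩, ⟨⟨c, d⟩, ⟨e, f⟩⟩⟩ h
    simp only [Finset.mem_sigma, Finset.mem_product,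
      Finset.HasAntidiagonal.mem_antidiagonal] at h
    obtain ⟨-, rfl, rfl⟩ := h
    rfl
  · rintro _ _
    rfl

variable {α : Tate A ε →ₐ[Tate k ε] Tate B ε}

theorem norm_coeff_map_const_le (hα : ∀ x, ‖α x‖ ≤ ‖x‖) (hε : 0 < ε) (n : ℕ) (a : A) :
    ‖coeff n (α (const a))‖ ≤ ‖a‖ * (ε⁻¹) ^ n := by
  rw [inv_pow, ← div_eq_mul_inv, le_div_iff₀ (pow_pos hε n)]
  exact (norm_coeff_le _ n).trans ((hα _).trans (norm_const_le a))

theorem tendsto_extendFun (hα : ∀ x, ‖α x‖ ≤ ‖x‖) (h0 : 0 < ε') (h1 : ε' < ε) (x : Tate A ε') :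
    Filter.Tendsto (fun n => ‖PowerSeries.coeff n (extendFun α (toPowerSeries x))‖ * ε' ^ n)
      Filter.atTop (𝓝 0) := by
  have hε : 0 < ε := h0.trans h1
  have ha := tendsto_coeff x
  have hb : Filter.Tendsto (fun n : ℕ => (ε' / ε) ^ n) Filter.atTop (𝓝 0) :=
    tendsto_pow_atTop_nhds_zero_of_lt_one (by positivity) (by rwa [div_lt_one hε])
  rw [← Nat.cofinite_eq_atTop] at ha hb ⊢
  have hab := Finset.HasAntidiagonal.tendsto_sup'_antidiagonal_cofinite (tendsto_mul_cofinite_nhds_zero ha hb)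
  refine squeeze_zero (fun n => by positivity) (fun n => ?_) hab
  rw [coeff_extendFun]
  obtain ⟨p, hp, hle⟩ := IsUltrametricDist.exists_norm_finsetSum_le_of_nonempty
    (Finset.HasAntidiagonal.nonempty_antidiagonal n)
    (fun p : ℕ × ℕ => coeff p.2 (α (const (PowerSeries.coeff p.1 (toPowerSeries x)))))
  refine le_trans ?_ (Finset.le_sup' _ hp)
  rw [Finset.HasAntidiagonal.mem_antidiagonal] at hp
  have h2 := hle.trans (norm_coeff_map_const_le hα hε p.2 _)
  refine (mul_le_mul_of_nonneg_right h2 (by positivity)).trans (le_of_eq ?_)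
  rw [← hp, coeff, pow_add, div_pow, inv_pow]
  field_simp

/-- The base change of a contracting morphism `α` of `k{ħ/ε}`-algebras to `k{ħ/ε'}`, for
`0 < ε' < ε`. It is characterised by `baseChange_incl` and `norm_baseChange_le`. -/
def baseChange (α : Tate A ε →ₐ[Tate k ε] Tate B ε) (hα : ∀ x, ‖α x‖ ≤ ‖x‖)
    (h0 : 0 < ε') (h1 : ε' < ε) : Tate A ε' →ₐ[Tate k ε'] Tate B ε' where
  toFun x := ofPowerSeries (extendFun α (toPowerSeries x)) (tendsto_extendFun hα h0 h1 x)
  map_one' := toPowerSeries_injective (by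
    simpa using extendFun_map_algebraMap α 1)
  map_mul' x y := toPowerSeries_injective (by simp [extendFun_mul])
  map_zero' := toPowerSeries_injective (by
    simpa using extendFun_map_algebraMap α 0)
  map_add' x y := toPowerSeries_injective (by simp [extendFun_add])
  commutes' c := toPowerSeries_injective (extendFun_map_algebraMap α (toPowerSeries c))

theorem coeff_baseChange (hα : ∀ x, ‖α x‖ ≤ ‖x‖) (h0 : 0 < ε') (h1 : ε' < ε) (x : Tate A ε')
    (n : ℕ) : coeff n (baseChange α hα h0 h1 x) =
      ∑ p ∈ Finset.HasAntidiagonal.antidiagonal n, coeff p.2 (α (const (coeff p.1 x))) :=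
  coeff_extendFun _ _ _

/-- The inclusion `A{ħ/ε} ⊆ A{ħ/ε'}` for `0 < ε' < ε`. -/
def incl (h0 : 0 < ε') (h1 : ε' < ε) : Tate A ε →+* Tate A ε' :=
  (toPowerSeries (A := A) (ε := ε)).codRestrict (PowerSeries.IsRestricted.subring (R := A) ε')
    (fun x => (PowerSeries.isRestricted_iff' ε' _).2 (squeeze_zero (fun n => by positivity)
      (fun n => mul_le_mul_of_nonneg_left (pow_le_pow_left₀ h0.le h1.le n) (norm_nonneg _))
      (tendsto_coeff x)))

theorem coeff_incl (h0 : 0 < ε') (h1 : ε' < ε) (x : Tate A ε) (n : ℕ) :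
    coeff n (incl h0 h1 x) = coeff n x := rfl

theorem exists_eq_const_add (hε : 0 < ε) (x : Tate A ε) :
    ∃ y : Tate A ε, x = const (coeff 0 x) + hbar A ε * y ∧ ∀ n, coeff n y = coeff (n + 1) x := by
  refine ⟨ofPowerSeries (PowerSeries.mk fun n => coeff (n + 1) x) ?_, ?_, fun n => ?_⟩
  · have h := (((Filter.tendsto_add_atTop_iff_nat 1).2 (tendsto_coeff x)).const_mul ε⁻¹)
    rw [mul_zero] at h
    refine h.congr fun n => ?_
    rw [PowerSeries.coeff_mk, pow_succ]
    field_simp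
  · ext n
    rw [coeff_add, coeff_const]
    cases n with
    | zero => simp [coeff, toPowerSeries_hbar]
    | succ n => simp [coeff, toPowerSeries_hbar, PowerSeries.coeff_succ_X_mul]
  · simp [coeff]

theorem coeff_map_eq_sum (α : Tate A ε →ₐ[Tate k ε] Tate B ε) (hε : 0 < ε) (n : ℕ)
    (x : Tate A ε) :
    coeff n (α x) = ∑ p ∈ Finset.HasAntidiagonal.antidiagonal n, coeff p.2 (α (const (coeff p.1 x))) := by
  have key (y : Tate A ε) : α (hbar A ε * y) = hbar B ε * α y := by
    rw [map_mul, ← scalar_hbar (k := k) (A := A), ← scalar_hbar (k := k) (A := B), ← algebraMap_def,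
      ← algebraMap_def, AlgHom.commutes]
  induction n generalizing x with
  | zero =>
    obtain ⟨y, hy, -⟩ := exists_eq_const_add hε x
    conv_lhs => rw [hy, map_add, key]
    simp [coeff, toPowerSeries_hbar]
  | succ n ih =>
    obtain ⟨y, hy, hc⟩ := exists_eq_const_add hε x
    conv_lhs => rw [hy, map_add, key]
    rw [Finset.Nat.sum_antidiagonal_succ, coeff_add]
    congr 1
    simp only [← hc]
    rw [← ih y]
    simp [coeff, toPowerSeries_hbar, PowerSeries.coeff_succ_X_mul]

theorem baseChange_incl (hα : ∀ x, ‖α x‖ ≤ ‖x‖) (h0 : 0 < ε') (h1 : ε' < ε) (x : Tate A ε) :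
    baseChange α hα h0 h1 (incl h0 h1 x) = incl h0 h1 (α x) := by
  ext n
  rw [coeff_baseChange, coeff_incl, coeff_map_eq_sum α (h0.trans h1)]
  rfl

theorem norm_baseChange_le (hα : ∀ x, ‖α x‖ ≤ ‖x‖) (h0 : 0 < ε') (h1 : ε' < ε)
    (x : Tate A ε') : ‖baseChange α hα h0 h1 x‖ ≤ ‖x‖ := by
  have hε : 0 < ε := h0.trans h1
  refine ciSup_le fun n => ?_
  rw [coeff_baseChange]
  obtain ⟨p, hp, hle⟩ := IsUltrametricDist.exists_norm_finsetSum_le_of_nonempty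
    (Finset.HasAntidiagonal.nonempty_antidiagonal n) (fun p : ℕ × ℕ => coeff p.2 (α (const (coeff p.1 x))))
  rw [Finset.HasAntidiagonal.mem_antidiagonal] at hp
  refine le_trans ?_ (norm_coeff_le x p.1)
  have h2 := hle.trans (norm_coeff_map_const_le hα hε p.2 _)
  refine (mul_le_mul_of_nonneg_right h2 (by positivity)).trans ?_
  have h3 : (ε⁻¹) ^ p.2 * ε' ^ p.2 ≤ 1 := by
    rw [← mul_pow]
    refine pow_le_one₀ (by positivity) ?_
    rw [inv_mul_le_iff₀ hε, mul_one]
    exact h1.le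
  calc ‖coeff p.1 x‖ * ε⁻¹ ^ p.2 * ε' ^ n
      = ‖coeff p.1 x‖ * ε' ^ p.1 * (ε⁻¹ ^ p.2 * ε' ^ p.2) := by rw [← hp, pow_add]; ring
    _ ≤ ‖coeff p.1 x‖ * ε' ^ p.1 := mul_le_of_le_one_right (by positivity) h3

end Tate

end Morphisms

/-! ## Bounded Lie algebra cohomology -/

section Cohomology

variable (k : Type*) [NormedField k] {L : Type*} [LieRing L]
  {M : Type*} [NormedAddCommGroup M] [LieRingModule L M]

/-- The first sum `∑_{i<j} (-1)^(i+j) f([x_i, x_j], x_1, …, x̂_i, …, x̂_j, …)` of the differential. -/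
def bracketSum : (n : ℕ) → ((Fin n → L) → M) → (Fin (n + 1) → L) → M
  | 0, _, _ => 0
  | n + 1, f, x => ∑ j : Fin (n + 2), ∑ i : Fin (n + 1),
      if i.castSucc < j then
        (-1 : ℤ) ^ (i.val + j.val) •
          f (Fin.cons ⁅x i.castSucc, x j⁆ (i.removeNth (j.removeNth x)))
      else 0

/-- The second sum `∑_i (-1)^(i+1) x_i f(x_1, …, x̂_i, …)` of the differential (here the indices
start from `0`). -/
def actionSum (n : ℕ) (f : (Fin n → L) → M) (x : Fin (n + 1) → L) : M :=
  ∑ i : Fin (n + 1), (-1 : ℤ) ^ i.val • ⁅x i, f (i.removeNth x)⁆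

/-- The Chevalley-Eilenberg differential `δ_n`. -/
def differential (n : ℕ) (f : (Fin n → L) → M) (x : Fin (n + 1) → L) : M :=
  bracketSum n f x + actionSum n f x

theorem differential_zero (f : (Fin 0 → L) → M) (x : Fin 1 → L) :
    differential 0 f x = ⁅x 0, f ![]⁆ := by
  simp [differential, bracketSum, actionSum, Matrix.empty_eq]

theorem differential_one (f : (Fin 1 → L) → M) (x y : L) :
    differential 1 f ![x, y] = ⁅x, f ![y]⁆ - ⁅y, f ![x]⁆ - f ![⁅x, y⁆] := by
  have h0 : Fin.removeNth (0 : Fin 2) ![x, y] = ![y] := by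
    ext i
    fin_cases i
    rfl
  have h1 : Fin.removeNth (1 : Fin 2) ![x, y] = ![x] := by
    ext i
    fin_cases i
    rfl
  have h2 (z : Fin 0 → L) : (Fin.cons ⁅x, y⁆ z : Fin 1 → L) = ![⁅x, y⁆] := by
    ext i
    fin_cases i
    rfl
  simp [differential, bracketSum, actionSum, Fin.sum_univ_two, h0, h1, h2]
  abel

variable (L M) [LieAlgebra k L] [Norm L] [NormedSpace k M]

/-- `C` is a bound for the map `f` of `n` variables. -/
def IsMultiBound {L M : Type*} [Norm L] [Norm M] {n : ℕ} (f : (Fin n → L) → M) (C : ℝ) : Prop :=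
  0 ≤ C ∧ ∀ x, ‖f x‖ ≤ C * ∏ i, ‖x i‖

/-- `C_b^n(L, M)`: the bounded alternating `n`-linear maps from `L` to `M`. -/
def Cochain (n : ℕ) : Submodule k (L [⋀^Fin n]→ₗ[k] M) where
  carrier := {f | ∃ C, IsMultiBound f C}
  zero_mem' := ⟨0, le_rfl, fun x => by simp⟩
  add_mem' := by
    rintro f g ⟨C, hC, hf⟩ ⟨C', hC', hg⟩
    refine ⟨C + C', add_nonneg hC hC', fun x => ?_⟩
    rw [add_mul]
    exact (norm_add_le _ _).trans (add_le_add (hf x) (hg x))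
  smul_mem' := by
    rintro t f ⟨C, hC, hf⟩
    refine ⟨‖t‖ * C, mul_nonneg (norm_nonneg _) hC, fun x => ?_⟩
    rw [mul_assoc]
    exact (norm_smul_le _ _).trans (mul_le_mul_of_nonneg_left (hf x) (norm_nonneg _))

/-- The operator norm of a bounded cochain. -/
instance (n : ℕ) : Norm (Cochain k L M n) := ⟨fun f => sInf {C : ℝ | IsMultiBound f.1 C}⟩

/-- `f ∈ Ker(δ_n)`. -/
def IsCocycle {n : ℕ} (f : Cochain k L M n) : Prop := ∀ x, differential n f.1 x = 0

/-- `δ_n g = f`. -/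
def IsDifferential {n : ℕ} (g : Cochain k L M n) (f : Cochain k L M (n + 1)) : Prop :=
  ∀ x, differential n g.1 x = f.1 x

/-- The vanishing of the cohomology `H_b^(n+1)(L, M) = Ker(δ_(n+1)) / Im(δ_n)`. -/
def CohomologyVanishes (n : ℕ) : Prop :=
  ∀ f : Cochain k L M (n + 1), IsCocycle k L M f → ∃ g, IsDifferential k L M g f

/-- The quotient norm on `C_b^n(L, M) / Ker(δ_n)` of the class of `g`. -/
def quotientNorm {n : ℕ} (g : Cochain k L M n) : ℝ :=
  ⨅ z : {z : Cochain k L M n // IsCocycle k L M z}, ‖g + z.1‖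

/-- The inverse `Im(δ_n) → C_b^n(L, M) / Ker(δ_n)`, `δ_n g ↦ [g]`, of the map induced by `δ_n` has
norm at most `K`. -/
def InverseNormLE (n : ℕ) (K : ℝ) : Prop :=
  ∀ g f, IsDifferential (n := n) k L M g f → quotientNorm k L M g ≤ K * ‖f‖

/-- The complex `C_b^•(L, M)` is strictly exact at `C_b^(n+1)(L, M)`: the cohomology there vanishes
and the map `C_b^n(L, M) / Ker(δ_n) → Im(δ_n) = Ker(δ_(n+1))` is an isomorphism of Banach spaces,
i.e. its inverse is bounded. -/
def StrictlyExactAtSucc (n : ℕ) : Prop :=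
  CohomologyVanishes k L M n ∧ ∃ K, InverseNormLE k L M n K

end Cohomology

/-! ## `U(𝔤')^an` as a module over `𝔤_{r,s}` -/

section Adjoint

variable {k : Type*} [NormedField k] [IsUltrametricDist k]
  {I Φ : Type*} [AddCommGroup Φ] {D : RootDatum I Φ} {ρ : Radii}
  {I' Φ' : Type*} [AddCommGroup Φ'] {D' : RootDatum I' Φ'} {ρ' : Radii}

/-- The Banach space `U(𝔤')^an` as a module over `𝔤_{r,s}`, which acts by `x ↦ [φ x, -]` for a
morphism of algebras `φ : U(𝔤)^an → U(𝔤')^an`. -/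
def AdjointModule (_ : UAn k D ρ →ₐ[k] UAn k D' ρ') : Type _ := UAn k D' ρ'

namespace AdjointModule

variable (φ : UAn k D ρ →ₐ[k] UAn k D' ρ')

instance : NormedAddCommGroup (AdjointModule φ) :=
  inferInstanceAs (NormedAddCommGroup (UAn k D' ρ'))

instance : NormedSpace k (AdjointModule φ) := inferInstanceAs (NormedSpace k (UAn k D' ρ'))

/-- The underlying element of `U(𝔤')^an`. -/
def of : UAn k D' ρ' ≃ₗ[k] AdjointModule φ := LinearEquiv.refl k (UAn k D' ρ')

instance : LieRingModule (UAn.lie k D ρ) (AdjointModule φ) where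
  bracket x m := of φ (φ x * (of φ).symm m - (of φ).symm m * φ x)
  add_lie x y m := by
    rw [← map_add]
    congr 1
    have h : ((x + y : UAn.lie k D ρ) : UAn k D ρ) = x + y := rfl
    rw [h, map_add]
    noncomm_ring
  lie_add x m n := by
    rw [← map_add]
    congr 1
    simp only [map_add]
    noncomm_ring
  leibniz_lie x y m := by
    rw [← map_add]
    congr 1
    simp only [LieSubalgebra.coe_bracket, LieRing.of_associative_ring_bracket, map_sub, map_mul,
      LinearEquiv.symm_apply_apply]
    noncomm_ring

theorem lie_def (x : UAn.lie k D ρ) (m : AdjointModule φ) :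
    ⁅x, m⁆ = of φ (φ x * (of φ).symm m - (of φ).symm m * φ x) := rfl

instance : LieModule k (UAn.lie k D ρ) (AdjointModule φ) where
  smul_lie t x m := by
    rw [lie_def, lie_def, ← map_smul]
    congr 1
    simp [smul_sub]
  lie_smul t x m := by
    rw [lie_def, lie_def, ← map_smul]
    congr 1
    simp [smul_sub]

end AdjointModule

end Adjoint

end Rigidity

end

/-! The conjugating element is built one power of `ħ` at a time, as f = 1 + c₁ħ + c₂ħ² + ⋯ with
α'(a) f = f α(a) for every a in U. By linearity over powers of `ħ`, it is enough to treat such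
constants a (`extendFun_mul_eq`).

Suppose the defect α'(a) f − f α(a) vanishes below order n. Since α and α' have the same reduction
α₀, its coefficient of `ħ^n` is a derivation d : U → U' over α₀ (`coeff_defect_mul`). Its
restriction to the Lie algebra is a bounded 1-cocycle, hence by exactness of the form x ↦ [α₀(x),
u]. The equality d = [α₀(·), u] holds on the generators and spreads to all of U by the Leibniz rule,
density and continuity (`derivation_eq_zero`, `exists_eq_commutator`). Adding −u `ħ^n` to f then
removes d and changes nothing in lower order.

Convergence is a matter of strict inequalities. The quotient norm is an infimum that need not be
attained, so u is controlled only by a constant strictly larger than the bound for d. Fix σ with ε'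
< σ < ε and keep ‖c_m‖ σ^m ≤ 1. Every term of d contains a coefficient of α or α' of positive order
i, of norm at most ε^(−i), so d has norm at most (σ/ε) σ^(−n) < σ^(−n) (`norm_coeff_defect_le`). The
room left by σ/ε < 1 allows ‖u‖ ≤ σ^(−n), and the bound propagates with no loss
(`exists_intertwiner`). Both f and its inverse then converge on the smaller radius ε'
(`norm_coeff_invOfUnit_le`, `tendsto_of_norm_coeff_le`). -/

noncomputable section

namespace Rigidity

/-! ### Recursive choice of coefficients, and bounds for inverse power series -/

/-- Recursive construction of a sequence whose `n`-th property involves only the terms up to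
`n`. -/
theorem exists_seq_of_extension {β : Type*} [Inhabited β] (P : ℕ → (ℕ → β) → Prop)
    (hP : ∀ n c c', (∀ m ≤ n, c m = c' m) → P n c → P n c')
    (step : ∀ n c, (∀ m < n, P m c) → ∃ u, P n (Function.update c n u)) :
    ∃ c, ∀ n, P n c := by
  have hstep (n : ℕ) (c : {c : ℕ → β // ∀ m < n, P m c}) :
      ∃ u, ∀ m < n + 1, P m (Function.update c.1 n u) := by
    obtain ⟨u, hu⟩ := step n c.1 c.2
    refine ⟨u, fun m hm => ?_⟩
    rcases Nat.lt_succ_iff_lt_or_eq.1 hm with h | rfl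
    · refine hP m c.1 _ (fun l hl => ?_) (c.2 m h)
      rw [Function.update_of_ne (by omega)]
    · exact hu
  choose u hu using hstep
  -- Stage n is a full sequence whose terms below n are final and whose other terms are
  -- placeholders. The initial sequence is arbitrary, as nothing is required of it.
  let C : (n : ℕ) → {c : ℕ → β // ∀ m < n, P m c} := fun n =>
    Nat.rec ⟨fun _ => default, fun m hm => absurd hm (Nat.not_lt_zero m)⟩
      (fun n c => ⟨Function.update c.1 n (u n c), hu n c⟩) n
  have hC (n : ℕ) : (C (n + 1)).1 = Function.update (C n).1 n (u n (C n)) := rfl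
  have hstab (m n : ℕ) (h : m + 1 ≤ n) : (C n).1 m = (C (m + 1)).1 m := by
    induction n, h using Nat.le_induction with
    | base => rfl
    | succ n hn ih => rw [hC, Function.update_of_ne (by omega), ih]
  -- The m-th term is fixed from stage m + 1 on, so the diagonal agrees with stage n + 1 in all
  -- indices up to n.
  refine ⟨fun m => (C (m + 1)).1 m, fun n => ?_⟩
  exact hP n (C (n + 1)).1 _ (fun m hm => hstab m (n + 1) (by omega)) ((C (n + 1)).2 n (by omega))

/-- If the coefficients of `f = 1 + ⋯` satisfy `‖f_n‖ ρ^n ≤ 1`, then so do those of its inverse. -/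
theorem norm_coeff_invOfUnit_le {B : Type*} [NormedRing B] [IsUltrametricDist B]
    (h1 : ‖(1 : B)‖ ≤ 1) {ρ : ℝ} (hρ : 0 < ρ) {f : PowerSeries B}
    (hf : ∀ n, ‖PowerSeries.coeff n f‖ * ρ ^ n ≤ 1) (n : ℕ) :
    ‖PowerSeries.coeff n (PowerSeries.invOfUnit f 1)‖ * ρ ^ n ≤ 1 := by
  induction n using Nat.strong_induction_on with
  | _ n ih =>
    rw [PowerSeries.coeff_invOfUnit]
    split_ifs with hn
    · simpa [hn] using h1
    · simp only [inv_one, Units.val_one, neg_mul, one_mul, norm_neg]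
      rw [← le_div_iff₀ (pow_pos hρ n)]
      -- The recursion expresses the n-th coefficient of the inverse by products of coefficients of
      -- f with earlier ones of the inverse; by the ultrametric inequality the sum is no worse than
      -- its largest term.
      refine IsUltrametricDist.norm_sum_le_of_forall_le_of_nonneg (by positivity) fun p hp => ?_
      rw [Finset.HasAntidiagonal.mem_antidiagonal] at hp
      split_ifs with hlt
      · rw [le_div_iff₀ (pow_pos hρ n), ← hp, pow_add]
        calc _ ≤ ‖PowerSeries.coeff p.1 f‖ *
              ‖PowerSeries.coeff p.2 (PowerSeries.invOfUnit f 1)‖ * (ρ ^ p.1 * ρ ^ p.2) := by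
              gcongr
              exact norm_mul_le _ _
          _ = (‖PowerSeries.coeff p.1 f‖ * ρ ^ p.1) *
              (‖PowerSeries.coeff p.2 (PowerSeries.invOfUnit f 1)‖ * ρ ^ p.2) := by ring
          _ ≤ 1 := mul_le_one₀ (hf _) (by positivity) (ih _ hlt)
      · simp only [norm_zero]
        positivity

/-! ### Convergent power series and extension of intertwining relations -/

namespace Tate

variable {k : Type*} [NormedField k] [IsUltrametricDist k]
  {A : Type*} [NormedRing A] [IsUltrametricDist A] [NormedAlgebra k A]
  {B : Type*} [NormedRing B] [IsUltrametricDist B] [NormedAlgebra k B]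
  {ε ε' : ℝ}

omit [IsUltrametricDist B] in
/-- A power series with `‖a_n‖ ρ^n ≤ 1` belongs to `B{ħ/ε'}` for all `ε' < ρ`. -/
theorem tendsto_of_norm_coeff_le {ρ : ℝ} (h0 : 0 < ε') (h1 : ε' < ρ) {f : PowerSeries B}
    (hf : ∀ n, ‖PowerSeries.coeff n f‖ * ρ ^ n ≤ 1) :
    Filter.Tendsto (fun n => ‖PowerSeries.coeff n f‖ * ε' ^ n) Filter.atTop (𝓝 0) := by
  have hρ : 0 < ρ := h0.trans h1
  have hb : Filter.Tendsto (fun n : ℕ => (ε' / ρ) ^ n) Filter.atTop (𝓝 0) :=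
    tendsto_pow_atTop_nhds_zero_of_lt_one (by positivity) (by rwa [div_lt_one hρ])
  refine squeeze_zero (fun n => by positivity) (fun n => ?_) hb
  calc ‖PowerSeries.coeff n f‖ * ε' ^ n
      = (‖PowerSeries.coeff n f‖ * ρ ^ n) * (ε' / ρ) ^ n := by
        rw [div_pow]
        field_simp
    _ ≤ (ε' / ρ) ^ n := mul_le_of_le_one_left (by positivity) (hf n)

/-- The power series `α(a) = ∑ α_n(a) ħ^n` for `a` in `A`. -/
def series (α : Tate A ε →ₐ[Tate k ε] Tate B ε) : A →+* PowerSeries B :=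
  (toPowerSeries (A := B) (ε := ε)).comp ((α : Tate A ε →+* Tate B ε).comp const)

theorem coeff_zero_series (α : Tate A ε →ₐ[Tate k ε] Tate B ε) (a : A) :
    PowerSeries.coeff 0 (series α a) = reduction α a := (reduction_apply α a).symm

theorem series_algebraMap (α : Tate A ε →ₐ[Tate k ε] Tate B ε) (t : k) :
    series α (algebraMap k A t) = PowerSeries.C (algebraMap k B t) := by
  change toPowerSeries (α (const (algebraMap k A t))) = _
  rw [map_const_algebraMap]
  rfl

/-- An element intertwining `α` and `α'` on `A` intertwines their extensions to power series. -/
theorem extendFun_mul_eq {α α' : Tate A ε →ₐ[Tate k ε] Tate B ε} {f : PowerSeries B}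
    (h : ∀ a, series α' a * f = f * series α a) (x : PowerSeries A) :
    extendFun α' x * f = f * extendFun α x := by
  -- Up to order n the extension sees only finitely many coefficients of x, so it may be replaced by
  -- a finite sum of powers of the central `ħ` times images of constants, to which `h` applies
  -- termwise.
  have key (β : Tate A ε →ₐ[Tate k ε] Tate B ε) (n : ℕ) :
      ∀ m ≤ n, PowerSeries.coeff m (extendFun β x) = PowerSeries.coeff m
        (∑ i ∈ Finset.range (n + 1), PowerSeries.X ^ i * series β (PowerSeries.coeff i x)) := by
    intro m hm
    rw [coeff_extendFun, map_sum, Finset.Nat.sum_antidiagonal_eq_sum_range_succ_mk]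
    simp only [PowerSeries.coeff_X_pow_mul']
    rw [← Finset.sum_filter]
    have : (Finset.range (n + 1)).filter (· ≤ m) = Finset.range m.succ := by
      ext i
      simp only [Finset.mem_filter, Finset.mem_range]
      omega
    rw [this]
    rfl
  ext n
  have hl : PowerSeries.coeff n (extendFun α' x * f) = PowerSeries.coeff n
      ((∑ i ∈ Finset.range (n + 1), PowerSeries.X ^ i * series α' (PowerSeries.coeff i x)) * f) := by
    rw [PowerSeries.coeff_mul, PowerSeries.coeff_mul]
    refine Finset.sum_congr rfl fun p hp => ?_
    rw [Finset.HasAntidiagonal.mem_antidiagonal] at hp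
    rw [key α' n p.1 (by omega)]
  have hr : PowerSeries.coeff n (f * extendFun α x) = PowerSeries.coeff n
      (f * ∑ i ∈ Finset.range (n + 1), PowerSeries.X ^ i * series α (PowerSeries.coeff i x)) := by
    rw [PowerSeries.coeff_mul, PowerSeries.coeff_mul]
    refine Finset.sum_congr rfl fun p hp => ?_
    rw [Finset.HasAntidiagonal.mem_antidiagonal] at hp
    rw [key α n p.2 (by omega)]
  rw [hl, hr, Finset.sum_mul, Finset.mul_sum]
  congr 1
  refine Finset.sum_congr rfl fun i _ => ?_
  rw [mul_assoc, h, ← mul_assoc, ← mul_assoc, (PowerSeries.commute_X_pow f i).eq]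

/-! ### The intertwining defect and its leading coefficient -/

/-- The defect `α'(a) f - f α(a)`. -/
def defect (α α' : Tate A ε →ₐ[Tate k ε] Tate B ε) (f : PowerSeries B) (a : A) : PowerSeries B :=
  series α' a * f - f * series α a

variable {α α' : Tate A ε →ₐ[Tate k ε] Tate B ε}

theorem defect_add (f : PowerSeries B) (a b : A) :
    defect α α' f (a + b) = defect α α' f a + defect α α' f b := by
  simp only [defect, map_add, add_mul, mul_add]
  abel

/-- Insert ± α'(a) f α(b): the defect is a derivation, with α' acting on the left and α on the
right. -/
theorem defect_mul (f : PowerSeries B) (a b : A) :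
    defect α α' f (a * b) = series α' a * defect α α' f b + defect α α' f a * series α b := by
  simp only [defect, map_mul]
  noncomm_ring

theorem defect_algebraMap (f : PowerSeries B) (t : k) :
    defect α α' f (algebraMap k A t) = 0 := by
  ext n
  rw [defect, series_algebraMap, series_algebraMap, map_sub, PowerSeries.coeff_C_mul,
    PowerSeries.coeff_mul_C, Algebra.commutes, sub_self, map_zero]

/-- This locality lets a coefficient of f be corrected without disturbing the orders already solved.
-/
theorem coeff_defect_congr {f g : PowerSeries B} {n : ℕ}
    (h : ∀ m ≤ n, PowerSeries.coeff m f = PowerSeries.coeff m g) (a : A) :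
    PowerSeries.coeff n (defect α α' f a) = PowerSeries.coeff n (defect α α' g a) := by
  simp only [defect, map_sub, PowerSeries.coeff_mul]
  congr 1 <;>
  · refine Finset.sum_congr rfl fun p hp => ?_
    rw [Finset.HasAntidiagonal.mem_antidiagonal] at hp
    rw [h _ (by omega)]

/-- If the defect vanishes modulo `ħ^n`, then its coefficient of `ħ^n` is a derivation. -/
theorem coeff_defect_mul (hred : reduction α' = reduction α) {f : PowerSeries B} {n : ℕ}
    (h : ∀ m < n, ∀ a, PowerSeries.coeff m (defect α α' f a) = 0) (a b : A) :
    PowerSeries.coeff n (defect α α' f (a * b)) =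
      reduction α a * PowerSeries.coeff n (defect α α' f b) +
        PowerSeries.coeff n (defect α α' f a) * reduction α b := by
  -- In each convolution only the term with the defect in order n survives, and there the other
  -- factor has order 0, where α and α' coincide.
  rw [defect_mul, map_add, PowerSeries.coeff_mul, PowerSeries.coeff_mul,
    Finset.sum_eq_single (0, n), Finset.sum_eq_single (n, 0), coeff_zero_series,
    coeff_zero_series, hred]
  · rintro ⟨i, j⟩ hp hne
    rw [Finset.HasAntidiagonal.mem_antidiagonal] at hp
    have : i ≠ n := by
      rintro rfl
      exact hne (by simpa using hp)
    rw [h i (by simp only at hp; omega), zero_mul]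
  · simp
  · rintro ⟨i, j⟩ hp hne
    rw [Finset.HasAntidiagonal.mem_antidiagonal] at hp
    have : j ≠ n := by
      rintro rfl
      exact hne (by simpa using hp)
    rw [h j (by simp only at hp; omega), mul_zero]
  · simp

/-- A correction in order n alters the leading coefficient of the defect by an inner derivation,
that is, by the coboundary δ₀u. -/
theorem coeff_defect_add_monomial (hred : reduction α' = reduction α) (f : PowerSeries B) (n : ℕ)
    (u : B) (a : A) :
    PowerSeries.coeff n (defect α α' (f + PowerSeries.C u * PowerSeries.X ^ n) a) =
      PowerSeries.coeff n (defect α α' f a) + (reduction α a * u - u * reduction α a) := by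
  have : defect α α' (f + PowerSeries.C u * PowerSeries.X ^ n) a =
      defect α α' f a + (series α' a * PowerSeries.C u - PowerSeries.C u * series α a) *
        PowerSeries.X ^ n := by
    have hX := (PowerSeries.commute_X_pow (series α a) n).eq
    simp only [defect, mul_add, add_mul, sub_mul, mul_assoc]
    rw [hX]
    abel
  rw [this, map_add, PowerSeries.coeff_mul_X_pow', if_pos le_rfl, Nat.sub_self, map_sub,
    PowerSeries.coeff_mul_C, PowerSeries.coeff_C_mul, coeff_zero_series, coeff_zero_series, hred]

/-- The gain ρ/ε < 1 over the naive bound ρ^(−n) is what pays for the infimum in the quotient norm.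
-/
theorem norm_coeff_defect_le (hα : ∀ x, ‖α x‖ ≤ ‖x‖) (hα' : ∀ x, ‖α' x‖ ≤ ‖x‖) {ρ : ℝ}
    (hρ : 0 < ρ) (hρε : ρ < ε) {f : PowerSeries B} {n : ℕ}
    (hf : ∀ m < n, ‖PowerSeries.coeff m f‖ * ρ ^ m ≤ 1) (hn : PowerSeries.coeff n f = 0) (a : A) :
    ‖PowerSeries.coeff n (defect α α' f a)‖ ≤ ρ / ε * (ρ⁻¹) ^ n * ‖a‖ := by
  have hε := hρ.trans hρε
  have key (β : Tate A ε →ₐ[Tate k ε] Tate B ε) (hβ : ∀ x, ‖β x‖ ≤ ‖x‖) (i j : ℕ)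
      (hij : i + j = n) : ‖PowerSeries.coeff i (series β a)‖ * ‖PowerSeries.coeff j f‖ ≤
        ρ / ε * (ρ⁻¹) ^ n * ‖a‖ := by
    -- The term with i = 0 carries the n-th coefficient of f, which is zero. All others have i ≥ 1:
    -- one factor ε⁻¹ is kept, giving ρ/ε, and the remaining ones are relaxed to ρ⁻¹.
    by_cases hj : j = n
    · rw [hj, hn, norm_zero, mul_zero]
      positivity
    · obtain ⟨l, rfl⟩ : ∃ l, i = l + 1 := ⟨i - 1, by omega⟩
      have h1 := norm_coeff_map_const_le hβ hε (l + 1) a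
      have h2 : ‖PowerSeries.coeff j f‖ ≤ (ρ⁻¹) ^ j := by
        rw [inv_pow, ← one_div, le_div_iff₀ (pow_pos hρ j)]
        exact hf j (by omega)
      have h3 : (ε⁻¹) ^ l ≤ (ρ⁻¹) ^ l :=
        pow_le_pow_left₀ (by positivity) (inv_anti₀ hρ hρε.le) l
      calc _ ≤ (‖a‖ * (ε⁻¹) ^ (l + 1)) * (ρ⁻¹) ^ j :=
            mul_le_mul h1 h2 (norm_nonneg _) (by positivity)
        _ = (ε⁻¹ * (ρ⁻¹) ^ j * ‖a‖) * (ε⁻¹) ^ l := by ring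
        _ ≤ (ε⁻¹ * (ρ⁻¹) ^ j * ‖a‖) * (ρ⁻¹) ^ l :=
            mul_le_mul_of_nonneg_left h3 (by positivity)
        _ = ρ / ε * (ρ⁻¹) ^ n * ‖a‖ := by
            rw [← hij, pow_add, pow_succ]
            field_simp
  rw [defect, map_sub, sub_eq_add_neg]
  refine (IsUltrametricDist.norm_add_le_max _ _).trans (max_le ?_ ?_)
  on_goal 2 => rw [norm_neg]
  all_goals
    rw [PowerSeries.coeff_mul]
    refine IsUltrametricDist.norm_sum_le_of_forall_le_of_nonneg (by positivity) fun p hp => ?_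
    rw [Finset.HasAntidiagonal.mem_antidiagonal] at hp
    refine (norm_mul_le _ _).trans ?_
    first
    | exact key α' hα' p.1 p.2 hp
    | (rw [mul_comm]; exact key α hα p.2 p.1 (by omega))

end Tate

/-! ### Bounded derivations and the first cohomology -/

section

variable {k : Type*} [NormedField k] [IsUltrametricDist k]
  {I Φ : Type*} [AddCommGroup Φ] {D : RootDatum I Φ} {ρ : Radii}
  {I' Φ' : Type*} [AddCommGroup Φ'] {D' : RootDatum I' Φ'} {ρ' : Radii}

namespace UAn

variable (k D ρ) in
theorem norm_one_le : ‖(1 : UAn k D ρ)‖ ≤ 1 := by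
  rw [← map_one (of k D ρ), norm_of]
  exact Enveloping.triNorm_le Enveloping.BoundedBy.one

variable (k D ρ) in
theorem generator_mem_lie (g : Gen I) : generator k D ρ g ∈ lie k D ρ := by
  rw [lie, ← SetLike.mem_coe, LieSubalgebra.coe_sInf, Set.mem_iInter₂]
  exact fun K hK => hK.2 ⟨g, rfl⟩

/-- A continuous derivation over `φ` that vanishes on the generators is zero. -/
theorem derivation_eq_zero (φ : UAn k D ρ →ₐ[k] UAn k D' ρ') (d : UAn k D ρ → UAn k D' ρ')
    (hc : Continuous d) (hadd : ∀ x y, d (x + y) = d x + d y)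
    (hmul : ∀ x y, d (x * y) = φ x * d y + d x * φ y)
    (halg : ∀ t, d (algebraMap k _ t) = 0) (hgen : ∀ g, d (generator k D ρ g) = 0)
    (x : UAn k D ρ) : d x = 0 := by
  -- The zero set of d is closed, so it suffices to treat the dense image of U(𝔤), whose elements
  -- are noncommutative polynomials in the generators.
  refine (denseRange_of k D ρ).induction_on (p := fun x => d x = 0) x
    (isClosed_eq hc continuous_const) fun y => ?_
  obtain ⟨z, rfl⟩ : ∃ z, Enveloping.mk k D z = y := RingQuot.mkAlgHom_surjective k (Rel k D) y
  induction z using FreeAlgebra.induction with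
  | grade0 t =>
    rw [AlgHom.commutes]
    exact halg t
  | grade1 g => exact hgen g
  | mul a b ha hb =>
    rw [map_mul]
    refine (congrArg d (map_mul (of k D ρ) _ _)).trans ?_
    rw [hmul, ha, hb, mul_zero, zero_mul, add_zero]
  | add a b ha hb =>
    rw [map_add]
    refine (congrArg d (map_add (of k D ρ) _ _)).trans ?_
    rw [hadd, ha, hb, add_zero]

end UAn

/-- A bounded derivation is inner, with a bound for an element that implements it, if the first
bounded cohomology of `𝔤_{r,s}` vanishes and the inverse of `δ_0` is contracting. -/
theorem exists_eq_commutator {φ : UAn k D ρ →ₐ[k] UAn k D' ρ'} (hφ : Continuous φ)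
    (hexact : CohomologyVanishes k (UAn.lie k D ρ) (AdjointModule φ) 0)
    (hcontr : InverseNormLE k (UAn.lie k D ρ) (AdjointModule φ) 0 1)
    (d : UAn k D ρ →ₗ[k] UAn k D' ρ') {K K' : ℝ} (hK : 0 ≤ K) (hKK' : K < K')
    (hd : ∀ x, ‖d x‖ ≤ K * ‖x‖) (hmul : ∀ x y, d (x * y) = φ x * d y + d x * φ y) :
    ∃ u, ‖u‖ ≤ K' ∧ ∀ x, d x = φ x * u - u * φ x := by
  let ι : UAn.lie k D ρ →ₗ[k] UAn k D ρ := (UAn.lie k D ρ).toSubmodule.subtype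
  -- The cochain is d restricted to 𝔤_{r,s}; applied to a commutator, the Leibniz rule is the
  -- cocycle identity.
  let f₀ : UAn.lie k D ρ [⋀^Fin 1]→ₗ[k] AdjointModule φ :=
    AlternatingMap.ofSubsingleton k _ _ (0 : Fin 1)
      ((AdjointModule.of φ).toLinearMap ∘ₗ d ∘ₗ ι)
  have hf₀ (x : Fin 1 → UAn.lie k D ρ) : f₀ x = AdjointModule.of φ (d (x 0)) := rfl
  have hbound : IsMultiBound f₀ K := by
    refine ⟨hK, fun x => ?_⟩
    rw [hf₀, Fin.prod_univ_one]
    exact hd _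
  let f : Cochain k (UAn.lie k D ρ) (AdjointModule φ) 1 := ⟨f₀, K, hbound⟩
  have hcocycle : IsCocycle k _ _ f := by
    intro x
    have hx : x = ![x 0, x 1] := by
      ext i
      fin_cases i <;> rfl
    rw [hx, differential_one]
    change ⁅x 0, f₀ ![x 1]⁆ - ⁅x 1, f₀ ![x 0]⁆ - f₀ ![⁅x 0, x 1⁆] = 0
    rw [hf₀, hf₀, hf₀, AdjointModule.lie_def, AdjointModule.lie_def, ← map_sub, ← map_sub]
    refine (map_eq_zero_iff _ (AdjointModule.of φ).injective).2 ?_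
    simp only [Matrix.cons_val_zero, LieSubalgebra.coe_bracket,
      LieRing.of_associative_ring_bracket, map_sub, hmul, LinearEquiv.symm_apply_apply]
    noncomm_ring
  obtain ⟨g, hg⟩ := hexact f hcocycle
  have hnorm : ‖f‖ ≤ K := csInf_le ⟨0, fun _ h => h.1⟩ hbound
  have hlt : quotientNorm k _ _ g < K' := by
    refine ((hcontr g f hg).trans ?_).trans_lt hKK'
    rwa [one_mul]
  have hne : Nonempty {z : Cochain k (UAn.lie k D ρ) (AdjointModule φ) 0 // IsCocycle k _ _ z} :=
    ⟨0, fun x => by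
      rw [differential_zero]
      exact lie_zero _⟩
  -- Two infima are unwound, the quotient norm and then the operator norm; K < K' makes both
  -- possible. Changing g by the cocycle z leaves its coboundary intact, and the value of g + z at
  -- the empty tuple is the required u.
  obtain ⟨⟨z, hz⟩, hlt'⟩ := exists_lt_of_ciInf_lt hlt
  obtain ⟨C, hC, hCK⟩ := exists_lt_of_csInf_lt ((g + z).2) hlt'
  refine ⟨(AdjointModule.of φ).symm ((g + z).1 ![]), ?_, ?_⟩
  · have := hC.2 ![]
    rw [Finset.univ_eq_empty, Finset.prod_empty, mul_one] at this
    exact this.trans hCK.le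
  · have hlie (x : UAn.lie k D ρ) :
        ⁅x, (g + z).1 ![]⁆ = AdjointModule.of φ (d x) := by
      have h1 := hg ![x]
      have h2 := hz ![x]
      rw [differential_zero] at h1 h2
      have h3 : (g + z).1 ![] = g.1 ![] + z.1 ![] := rfl
      rw [h3, lie_add]
      refine (congrArg₂ (· + ·) h1 h2).trans ?_
      exact add_zero _
    set u : UAn k D' ρ' := (AdjointModule.of φ).symm ((g + z).1 ![]) with hu
    have hgen (i : Gen I) : d (UAn.generator k D ρ i) =
        φ (UAn.generator k D ρ i) * u - u * φ (UAn.generator k D ρ i) :=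
      ((AdjointModule.of φ).injective
        (hlie ⟨_, UAn.generator_mem_lie k D ρ i⟩)).symm
    have hdc : Continuous d :=
      (LinearMap.mkContinuous d K hd).continuous
    -- From 1 = 1 · 1 one gets d(1) = d(1) + d(1); by linearity d kills all scalars.
    have hone : d 1 = 0 := by simpa using hmul 1 1
    intro x
    -- The difference of d and the inner derivation is again a continuous derivation over φ, and it
    -- vanishes on the generators because they lie in 𝔤_{r,s}.
    refine sub_eq_zero.1 (UAn.derivation_eq_zero φ (fun x => d x - (φ x * u - u * φ x))
      (by fun_prop) (fun x y => ?_) (fun x y => ?_) (fun t => ?_) (fun i => ?_) x)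
    · simp only [map_add]
      noncomm_ring
    · simp only [hmul, map_mul]
      noncomm_ring
    · simp only [AlgHom.commutes, Algebra.commutes t u, sub_self, sub_zero]
      rw [Algebra.algebraMap_eq_smul_one, map_smul, hone, smul_zero]
    · simp only [hgen i, sub_self]

end

/-! ### Construction of the intertwining power series -/

section

variable {k : Type*} [NormedField k] [IsUltrametricDist k]
  {I Φ : Type*} [AddCommGroup Φ] {D : RootDatum I Φ} {ρ : Radii}
  {I' Φ' : Type*} [AddCommGroup Φ'] {D' : RootDatum I' Φ'} {ρ' : Radii}

namespace Tate

theorem reduction_eq_of_sub_eq_hbar_mul {A B : Type*} [NormedRing A] [IsUltrametricDist A]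
    [NormedAlgebra k A] [NormedRing B] [IsUltrametricDist B] [NormedAlgebra k B] {ε : ℝ}
    {α α' : Tate A ε →ₐ[Tate k ε] Tate B ε}
    (hmod : ∀ x, ∃ y, α x - α' x = hbar B ε * y) : reduction α' = reduction α := by
  ext a
  rw [reduction_apply, reduction_apply]
  obtain ⟨y, hy⟩ := hmod (const a)
  rw [sub_eq_iff_eq_add.1 hy, coeff_add]
  simp [coeff, toPowerSeries_hbar]

/-- A power series with controlled coefficients that conjugates `α` into `α'`, built by solving
`δ_0 u = f` for each coefficient. -/
theorem exists_intertwiner {ε : ℝ} {α α' : Tate (UAn k D ρ) ε →ₐ[Tate k ε] Tate (UAn k D' ρ') ε}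
    (hα : ∀ x, ‖α x‖ ≤ ‖x‖) (hα' : ∀ x, ‖α' x‖ ≤ ‖x‖) (hred : reduction α' = reduction α)
    (hexact : CohomologyVanishes k (UAn.lie k D ρ) (AdjointModule (reduction α)) 0)
    (hcontr : InverseNormLE k (UAn.lie k D ρ) (AdjointModule (reduction α)) 0 1)
    {σ : ℝ} (hσ : 0 < σ) (hσε : σ < ε) :
    ∃ f : PowerSeries (UAn k D' ρ'), PowerSeries.constantCoeff f = 1 ∧
      (∀ n, ‖PowerSeries.coeff n f‖ * σ ^ n ≤ 1) ∧ ∀ a, series α' a * f = f * series α a := by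
  have hε := hσ.trans hσε
  have hφ : Continuous (reduction α) := by
    refine (LinearMap.mkContinuous (reduction α).toLinearMap 1 fun x => ?_).continuous
    have := norm_coeff_map_const_le hα hε 0 x
    rw [pow_zero, mul_one, ← reduction_apply] at this
    rwa [one_mul]
  have : Inhabited (UAn k D' ρ') := ⟨0⟩
  obtain ⟨c, hc⟩ : ∃ c : ℕ → UAn k D' ρ', ∀ n, ‖c n‖ * σ ^ n ≤ 1 ∧ (n = 0 → c n = 1) ∧
      ∀ a, PowerSeries.coeff n (defect α α' (PowerSeries.mk c) a) = 0 := by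
    refine exists_seq_of_extension (fun n (c : ℕ → UAn k D' ρ') => ‖c n‖ * σ ^ n ≤ 1 ∧
      (n = 0 → c n = 1) ∧ ∀ a, PowerSeries.coeff n (defect α α' (PowerSeries.mk c) a) = 0) ?_ ?_
    · rintro n c c' h ⟨h1, h2, h3⟩
      refine ⟨by rwa [← h n le_rfl], by rwa [← h n le_rfl], fun a => ?_⟩
      rw [← h3 a]
      exact coeff_defect_congr (fun m hm => by simp [h m hm]) a
    · intro n c hc
      rcases Nat.eq_zero_or_pos n with rfl | hn
      · refine ⟨1, ?_, fun _ => by simp, fun a => ?_⟩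
        · simpa using UAn.norm_one_le k D' ρ'
        · have h0 : PowerSeries.constantCoeff (series α' a) =
              PowerSeries.constantCoeff (series α a) := by
            rw [← PowerSeries.coeff_zero_eq_constantCoeff_apply,
              ← PowerSeries.coeff_zero_eq_constantCoeff_apply, coeff_zero_series,
              coeff_zero_series, hred]
          simp [defect, h0]
      -- The recursion leaves c n unspecified. Setting it to 0 removes the order-0 part of α and α'
      -- from the defect in order n, as `norm_coeff_defect_le` requires.
      set f := PowerSeries.mk (Function.update c n 0) with hf
      have hfn : PowerSeries.coeff n f = 0 := by simp [hf]
      have hfm (m : ℕ) (hm : m < n) : PowerSeries.coeff m f = c m := by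
        simp [hf, Function.update_of_ne hm.ne]
      have hdef (m : ℕ) (hm : m < n) (a : UAn k D ρ) :
          PowerSeries.coeff m (defect α α' f a) = 0 := by
        rw [← (hc m hm).2.2 a]
        exact coeff_defect_congr (fun l hl => by rw [hfm l (by omega), PowerSeries.coeff_mk]) a
      have hmul := coeff_defect_mul hred hdef
      let d : UAn k D ρ →ₗ[k] UAn k D' ρ' :=
        { toFun := fun a => PowerSeries.coeff n (defect α α' f a)
          map_add' := fun a b => by rw [defect_add, map_add]
          map_smul' := fun t a => by
            rw [Algebra.smul_def, hmul, defect_algebraMap, map_zero, zero_mul, add_zero,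
              AlgHom.commutes, RingHom.id_apply, Algebra.smul_def] }
      have hnorm : ∀ a, ‖d a‖ ≤ σ / ε * (σ⁻¹) ^ n * ‖a‖ :=
        norm_coeff_defect_le hα hα' hσ hσε (fun m hm => by rw [hfm m hm]; exact (hc m hm).1) hfn
      -- The derivation is bounded by (σ/ε) σ^(−n), strictly below K' = σ^(−n), which is exactly the
      -- bound the new coefficient must satisfy.
      obtain ⟨u, hu, hdu⟩ := exists_eq_commutator hφ hexact hcontr d
        (K' := (σ⁻¹) ^ n) (by positivity)
        (mul_lt_of_lt_one_left (by positivity) ((div_lt_one hε).2 hσε)) hnorm hmul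
      -- The sign makes the inner derivation contributed by the new coefficient cancel d.
      refine ⟨-u, ?_, fun h => absurd h hn.ne', fun a => ?_⟩
      · rw [Function.update_self, norm_neg, ← le_div_iff₀ (by positivity), one_div, ← inv_pow]
        exact hu
      · have hup : PowerSeries.mk (Function.update c n (-u)) =
            f + PowerSeries.C (-u) * PowerSeries.X ^ n := by
          ext m
          rw [map_add, PowerSeries.coeff_C_mul_X_pow, PowerSeries.coeff_mk, hf, PowerSeries.coeff_mk]
          by_cases hm : m = n
          · subst hm
            simp
          · simp [hm]
        rw [hup, coeff_defect_add_monomial hred]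
        change d a + _ = 0
        rw [hdu]
        noncomm_ring
  refine ⟨PowerSeries.mk c, ?_, fun n => ?_, fun a => ?_⟩
  · rw [← PowerSeries.coeff_zero_eq_constantCoeff_apply, PowerSeries.coeff_mk, (hc 0).2.1 rfl]
  · rw [PowerSeries.coeff_mk]
    exact (hc n).1
  · exact sub_eq_zero.1 (PowerSeries.ext fun n => (hc n).2.2 a)

end Tate

end

end Rigidity

end

/-! ### Conjugacy over the smaller disc -/

theorem theorem3p52
    {k : Type*} [NormedField k] [CompleteSpace k] [IsUltrametricDist k]
    {I Φ : Type*} [AddCommGroup Φ] (D : Rigidity.RootDatum I Φ) (ρ : Rigidity.Radii)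
    {I' Φ' : Type*} [AddCommGroup Φ'] (D' : Rigidity.RootDatum I' Φ') (ρ' : Rigidity.Radii)
    {ε : ℝ} (hε0 : 0 < ε) (hε1 : ε < 1)
    (α α' : Rigidity.Tate (Rigidity.UAn k D ρ) ε →ₐ[Rigidity.Tate k ε]
      Rigidity.Tate (Rigidity.UAn k D' ρ') ε)
    (hα : ∀ x, ‖α x‖ ≤ ‖x‖) (hα' : ∀ x, ‖α' x‖ ≤ ‖x‖)
    (hmod : ∀ x, ∃ y, α x - α' x = Rigidity.Tate.hbar (Rigidity.UAn k D' ρ') ε * y)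
    (hexact : Rigidity.StrictlyExactAtSucc k (Rigidity.UAn.lie k D ρ)
      (Rigidity.AdjointModule (Rigidity.Tate.reduction α)) 0)
    (hcontr : Rigidity.InverseNormLE k (Rigidity.UAn.lie k D ρ)
      (Rigidity.AdjointModule (Rigidity.Tate.reduction α)) 0 1) :
    ∀ (ε' : ℝ) (h0 : 0 < ε') (h1 : ε' < ε),
      ∃ F : (Rigidity.Tate (Rigidity.UAn k D' ρ') ε')ˣ,
        ∀ x : Rigidity.Tate (Rigidity.UAn k D ρ) ε',
          Rigidity.Tate.baseChange α' hα' h0 h1 x =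
            (F : Rigidity.Tate (Rigidity.UAn k D' ρ') ε') *
              Rigidity.Tate.baseChange α hα h0 h1 x *
              ((F⁻¹ : (Rigidity.Tate (Rigidity.UAn k D' ρ') ε')ˣ) :
                Rigidity.Tate (Rigidity.UAn k D' ρ') ε') := by

  intro ε' h0 h1
  -- The gap σ < ε serves the recursion; the gap ε' < σ turns bounded coefficients into coefficients
  -- tending to 0.
  obtain ⟨σ, hσ', hσ⟩ := exists_between h1
  have hσ0 := h0.trans hσ'
  obtain ⟨f, hf1, hf, hfα⟩ := Rigidity.Tate.exists_intertwiner hα hα'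
    (Rigidity.Tate.reduction_eq_of_sub_eq_hbar_mul hmod) hexact.1 hcontr hσ0 hσ
  have hg := Rigidity.norm_coeff_invOfUnit_le (Rigidity.UAn.norm_one_le k D' ρ') hσ0 hf
  let F : (Rigidity.Tate (Rigidity.UAn k D' ρ') ε')ˣ :=
    { val := Rigidity.Tate.ofPowerSeries f (Rigidity.Tate.tendsto_of_norm_coeff_le h0 hσ' hf)
      inv := Rigidity.Tate.ofPowerSeries (PowerSeries.invOfUnit f 1)
        (Rigidity.Tate.tendsto_of_norm_coeff_le h0 hσ' hg)
      val_inv := Rigidity.Tate.toPowerSeries_injective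
        (PowerSeries.mul_invOfUnit f 1 (by rw [hf1, Units.val_one]))
      inv_val := Rigidity.Tate.toPowerSeries_injective
        (PowerSeries.invOfUnit_mul f 1 (by rw [hf1, Units.val_one])) }
  refine ⟨F, fun x => ?_⟩
  rw [Units.eq_mul_inv_iff_mul_eq]
  exact Rigidity.Tate.toPowerSeries_injective
    (Rigidity.Tate.extendFun_mul_eq hfα (Rigidity.Tate.toPowerSeries x))
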